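/- Let $\mathfrak N$ be a complex Hilbert space, $\mathbf L(\mathfrak N)$ its bounded operators, $\mathbb D$ the open unit disk and $\mathbb T$ the unit circle. For a function $\Theta:\mathbb D\to\mathbf L(\mathfrak N)$ and $\xi\in\mathbb T$, $\Theta(\xi)\in\mathbf L(\mathfrak N)$ denotes the non-tangential strong limit of $\Theta(\lambda)$ at $\xi$, where it exists. $\Theta$ is *inner* (*co-inner*) if it is holomorphic on $\mathbb D$ with contractive values and, for almost all $\xi\in\mathbb T$, $\Theta(\xi)$ exists and satisfies $\Theta(\xi)^*\Theta(\xi)=I$ ($\Theta(\xi)\Theta(\xi)^*=I$). The class $\mathbf S^{qs}(\mathfrak N)$ consists of all $\Theta:\mathbb D\to\mathbf L(\mathfrak N)$ such that (S1) $W(\lambda)=\Theta(\lambda)-\Theta(0)$ has a holomorphic continuation to $\mathbb C\setminus((-\infty,-1]\cup[1,\infty))$, again denoted $W$, with $W(\bar\lambda)=W(\lambda)^*$ for $\lambda\in\mathbb C\setminus\mathbb R$ and $\operatorname{Im}W(\lambda)\ge0$ for $\operatorname{Im}\lambda>0$ (a Herglotz–Nevanlinna function); (S2) the non-tangential strong limits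 $W(1),W(-1)\in\mathbf L(\mathfrak N)$, taken from $\mathbb D$, exist and $W(1)-W(-1)\le 2I$; (S3) with $S=-\tfrac12(W(1)+W(-1))$ and $R=I-\tfrac12(W(1)-W(-1))\ge 0$, one has $\Theta(0)=S+R^{1/2}XR^{1/2}$ for some contraction $X$ on $\overline{\operatorname{ran}}\,R$. **Theorem.** Let $\Theta\in\mathbf S^{qs}(\mathfrak N)$. Then $\Theta(1)$ and $\Theta(-1)$ exist, and: (i) If $\Theta$ is inner, then $\tfrac12(\Theta(1)-\Theta(-1))$ is an orthogonal projection, i.e. it is selfadjoint and $$\Bigl(\tfrac{\Theta(1)-\Theta(-1)}2\Bigr)^2=\tfrac{\Theta(1)-\Theta(-1)}2,\tag{1}$$ and $$(\Theta(1)+\Theta(-1))^*(\Theta(1)+\Theta(-1))=4I-2(\Theta(1)-\Theta(-1)).\tag{2}$$ (ii) If $\Theta$ is co-inner, then $\tfrac12(\Theta(1)-\Theta(-1))$ is an orthogonal projection and $$(\Theta(1)+\Theta(-1))(\Theta(1)+\Theta(-1))^*=4I-2(\Theta(1)-\Theta(-1)).\tag{3}$$ (iii) If (1) and (2) hold and there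 is a point $\xi\in\mathbb T$, $\xi\neq\pm1$, at which $\Theta(\xi)$ exists and is isometric, then $\Theta$ is inner. If (1) and (3) hold and there is a point $\xi\in\mathbb T$, $\xi\ne\pm1$, at which $\Theta(\xi)$ exists and is co-isometric, then $\Theta$ is co-inner. -/

import Mathlib

open Complex Topology Filter MeasureTheory

noncomputable section

namespace QuasiSelfadjoint

variable {N : Type*} [NormedAddCommGroup N] [InnerProductSpace ℂ N]

/-- The Stolz region of aperture `M` at the point `ξ` of the unit circle. It is empty for `M ≤ 1`
(if `|ξ| = 1`) and accumulates at `ξ` for `M > 1`. -/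
def stolzRegion (ξ : ℂ) (M : ℝ) : Set ℂ :=
  {z : ℂ | ‖z‖ < 1 ∧ ‖z - ξ‖ < M * (1 - ‖z‖)}

/-- `L` is the non-tangential strong limit value at `ξ` of the operator function `Θ`, considered
on the open unit disk: `Θ(z) f → L f` for every vector `f` as `z → ξ` inside any Stolz region. -/
def IsBoundaryValue (Θ : ℂ → N →L[ℂ] N) (ξ : ℂ) (L : N →L[ℂ] N) : Prop :=
  ∀ f : N, ∀ M : ℝ, Tendsto (fun z => Θ z f) (𝓝[stolzRegion ξ M] ξ) (𝓝 (L f))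

/-- The Schur class: holomorphic on the open unit disk (in operator norm), with contractive
values there. -/
def IsSchur (Θ : ℂ → N →L[ℂ] N) : Prop :=
  DifferentiableOn ℂ Θ (Metric.ball 0 1) ∧ ∀ z ∈ Metric.ball (0 : ℂ) 1, ‖Θ z‖ ≤ 1

/-- The domain `ℂ ∖ ((-∞, -1] ∪ [1, ∞))`. -/
def extDomain : Set ℂ := {z : ℂ | ¬ (z.im = 0 ∧ (z.re ≤ -1 ∨ 1 ≤ z.re))}

variable [CompleteSpace N]

/-- An inner function: a Schur function whose boundary values are isometric almost everywhere
on the unit circle (with respect to arc length). -/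
def IsInnerFunction (Θ : ℂ → N →L[ℂ] N) : Prop :=
  IsSchur Θ ∧ ∀ᵐ t : ℝ, ∃ L : N →L[ℂ] N,
    IsBoundaryValue Θ (Complex.exp (t * I)) L ∧ star L * L = 1

/-- A co-inner function: a Schur function whose boundary values are co-isometric almost everywhere
on the unit circle (with respect to arc length). -/
def IsCoInnerFunction (Θ : ℂ → N →L[ℂ] N) : Prop :=
  IsSchur Θ ∧ ∀ᵐ t : ℝ, ∃ L : N →L[ℂ] N,
    IsBoundaryValue Θ (Complex.exp (t * I)) L ∧ L * star L = 1

/-- Operator-valued Herglotz-Nevanlinna functions: holomorphic on `ℂ ∖ ℝ`, symmetric,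
and with nonnegative imaginary part on the upper half-plane. -/
def IsHerglotzNevanlinna (W : ℂ → N →L[ℂ] N) : Prop :=
  DifferentiableOn ℂ W {z : ℂ | z.im ≠ 0} ∧
  (∀ z : ℂ, z.im ≠ 0 → W (starRingEnd ℂ z) = star (W z)) ∧
  ∀ z : ℂ, 0 < z.im → ∀ f : N, 0 ≤ (inner ℂ f (W z f)).im

/-- The operator ball with center `S` and left and right radii `R ≥ 0`: all operators
`S + R^{1/2} X R^{1/2}` with `X` a contraction on the closure of the range of `R`.
(The range of `R^{1/2}` lies in this closure, so that the projection onto it only restricts the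
codomain.) -/
def operatorBall (S R : N →L[ℂ] N) : Set (N →L[ℂ] N) :=
  {D | ∃ X : R.range.topologicalClosure →L[ℂ] R.range.topologicalClosure,
    (∀ v, ‖X v‖ ≤ ‖v‖) ∧
    D = S + CFC.sqrt R ∘L R.range.topologicalClosure.subtypeL ∘L X ∘L
      R.range.topologicalClosure.orthogonalProjectionOnto ∘L CFC.sqrt R}

/-- The class `S^qs(N)` of operator functions on the open unit disk (the values of `Θ` outside the
disk are irrelevant). Order of operators is the Loewner order. -/
def ClassSqs (Θ : ℂ → N →L[ℂ] N) : Prop :=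
  (∃ W : ℂ → N →L[ℂ] N, IsHerglotzNevanlinna W ∧ DifferentiableOn ℂ W extDomain ∧
    ∀ z ∈ Metric.ball (0 : ℂ) 1, W z = Θ z - Θ 0) ∧
  ∃ W₁ W₂ : N →L[ℂ] N,
    IsBoundaryValue (fun z => Θ z - Θ 0) 1 W₁ ∧
    IsBoundaryValue (fun z => Θ z - Θ 0) (-1) W₂ ∧
    W₁ - W₂ ≤ (2 : ℂ) • (1 : N →L[ℂ] N) ∧
    Θ 0 ∈ operatorBall (-((1 / 2 : ℂ) • (W₁ + W₂))) (1 - (1 / 2 : ℂ) • (W₁ - W₂))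

end QuasiSelfadjoint

end

noncomputable section

namespace QuasiSelfadjoint

/-! ### Trigonometric moments of Chebyshev polynomials of the second kind -/

section ChebyshevPolynomials

/-! Put G = (Θ(1) - Θ(-1))/2 and D = (Θ(1) + Θ(-1))/2. Everything rests on the canonical form
`ClassSqs.exists_isPositiveRep`: Θ(z) = D + T(b_z), where b_z(t) = (z - t)/(1 - zt) on [-1, 1] and T
is a positive linear map from C([-1, 1]) to the operators with T(1) = G. Condition (S3) becomes the
bilinear bound `IsBoundedBy D (1 - T 1)`. The map T plays the role of integration against the
operator measure of W, but no measure is built: pull W back to the disk by ζ ↦ 2ζ/(1 + ζ²),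
integrate functions of cos θ against Im W / sin θ on the circles |ζ| = r, and let r → 1. The limit
exists strongly because it exists on 1, on t and on the differences of Chebyshev polynomials of the
first kind, which together span the polynomials (`exists_isPositiveRep_tendsto`).

Necessity (`IsPositiveRep.isometric_necessary`). The function z ↦ T(b_z) is holomorphic across the
circle away from ±1, so isometry almost everywhere is isometry at all other points. Let ξ tend to ±1
along the circle. A scalar comparison of |b_ξ ∓ 1|² with the radial defect 1 ∓ b_x, together with
the Schwarz inequality for T, shows that T(b_ξ) → ±G strongly. Hence D + G and D - G are isometric,
and the parallelogram law gives ‖Df‖² + ‖Gf‖² = ‖f‖². Since ‖Df‖² ≤ ⟨f, (1 - G)f⟩ and ‖Gf‖² ≤ ⟨f,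
Gf⟩, both are equalities, so G² = G and D*D = 1 - G.

Sufficiency (`IsPositiveRep.isometric_of_point`). If G is a projection and D*D = 1 - G, then D*T(ψ)
= 0 for all ψ, so D + T(b_ξ) is isometric exactly when T(b_ξ)*T(b_ξ) = G. As b_ξ is unimodular,
Choi's argument puts it in the multiplicative domain of T. This is a closed algebra; it contains b_η
for η near ξ, since b_η is a Möbius function of b_ξ, and then for every η by the identity theorem.
So T(b_η)*T(b_η) = T(1) = G on the whole circle.

The co-inner statements are the inner ones for D* and conjugate points, because b_z has complex
conjugate b_{z̄} on [-1, 1]. -/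

theorem integral_cos_int_mul {k : ℤ} (hk : k ≠ 0) :
    ∫ θ in (0 : ℝ)..Real.pi, Real.cos (k * θ) = 0 := by
  have hk' : (k : ℝ) ≠ 0 := by exact_mod_cast hk
  rw [intervalIntegral.integral_comp_mul_left (fun x => Real.cos x) hk']
  simp

/-- The Chebyshev polynomial of the second kind as a function of the angle. -/
def chebU (n : ℕ) (θ : ℝ) : ℝ := (Polynomial.Chebyshev.U ℝ n).eval (Real.cos θ)

theorem continuous_chebU (n : ℕ) : Continuous (chebU n) :=
  (Polynomial.continuous _).comp Real.continuous_cos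

theorem chebU_mul_sin (n : ℕ) (θ : ℝ) :
    chebU n θ * Real.sin θ = Real.sin ((n + 1) * θ) := by
  have h := Polynomial.Chebyshev.U_real_cos θ (n : ℤ)
  rwa [Int.cast_natCast] at h

theorem chebU_succ (n : ℕ) (θ : ℝ) :
    chebU (n + 1) θ = Real.cos θ * chebU n θ + Real.cos ((n + 1 : ℤ) * θ) := by
  have h := congrArg (Polynomial.eval (Real.cos θ))
    (Polynomial.Chebyshev.U_eq_X_mul_U_add_T ℝ (n : ℤ))
  have h2 := Polynomial.Chebyshev.T_real_cos θ (n + 1 : ℤ)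
  simp only [Polynomial.eval_add, Polynomial.eval_mul, Polynomial.eval_X] at h
  rw [h2] at h
  simp [chebU, h]

theorem chebU_zero (θ : ℝ) : chebU 0 θ = 1 := by simp [chebU]

theorem chebU_one (θ : ℝ) : chebU 1 θ = 2 * Real.cos θ := by simp [chebU]

theorem chebU_add_two (n : ℕ) (θ : ℝ) :
    chebU (n + 2) θ = 2 * Real.cos θ * chebU (n + 1) θ - chebU n θ := by
  have h := congrArg (Polynomial.eval (Real.cos θ))
    (Polynomial.Chebyshev.U_add_two ℝ (n : ℤ))
  simpa only [chebU, Nat.cast_add, Nat.cast_one, Nat.cast_ofNat, Polynomial.eval_sub, Polynomial.eval_mul,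
    Polynomial.eval_X, Polynomial.eval_ofNat] using h

/-- Each step of the recursion U_{n+1} = cos θ · U_n + cos((n+1)θ) adds at most 1. -/
theorem abs_chebU_le (n : ℕ) (θ : ℝ) : |chebU n θ| ≤ n + 1 := by
  induction n with
  | zero => simp [chebU_zero]
  | succ n ih =>
    rw [chebU_succ]
    refine (abs_add_le _ _).trans ?_
    rw [abs_mul]
    have h1 := Real.abs_cos_le_one θ
    have h2 := Real.abs_cos_le_one ((n + 1 : ℤ) * θ)
    have h3 := mul_le_mul h1 ih (abs_nonneg _) zero_le_one
    push_cast at *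
    linarith

theorem integral_cos_mul_chebU (n : ℕ) :
    ∫ θ in (0 : ℝ)..Real.pi, Real.cos θ * chebU n θ =
      ∫ θ in (0 : ℝ)..Real.pi, chebU (n + 1) θ := by
  have hc := continuous_chebU n
  simp_rw [chebU_succ n]
  rw [intervalIntegral.integral_add, integral_cos_int_mul (by positivity), add_zero]
  · exact (Real.continuous_cos.mul hc).intervalIntegrable _ _
  · exact (by fun_prop : Continuous fun θ : ℝ => Real.cos ((n + 1 : ℤ) * θ)).intervalIntegrable _ _

theorem integral_chebU_add_two (n : ℕ) :
    ∫ θ in (0 : ℝ)..Real.pi, chebU (n + 2) θ = ∫ θ in (0 : ℝ)..Real.pi, chebU n θ := by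
  have hc := continuous_chebU n
  have hc1 := continuous_chebU (n + 1)
  have h : ∫ θ in (0 : ℝ)..Real.pi, chebU (n + 2) θ =
      2 * (∫ θ in (0 : ℝ)..Real.pi, chebU (n + 2) θ) - ∫ θ in (0 : ℝ)..Real.pi, chebU n θ := by
    conv_lhs => simp only [chebU_add_two n, mul_assoc]
    rw [intervalIntegral.integral_sub, intervalIntegral.integral_const_mul,
      integral_cos_mul_chebU (n + 1)]
    · exact (continuous_const.mul (Real.continuous_cos.mul hc1)).intervalIntegrable _ _
    · exact hc.intervalIntegrable _ _
  linarith

theorem integral_chebU (n : ℕ) :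
    ∫ θ in (0 : ℝ)..Real.pi, chebU n θ = Real.pi * ((1 + (-1) ^ n) / 2) := by
  induction n using Nat.twoStepInduction with
  | zero => simp [chebU_zero]
  | one =>
    simp only [chebU_one]
    simp
  | more n ih _ => rw [integral_chebU_add_two, ih, pow_add]; simp

/-- The integrals of U_n and U_{n+1} have opposite parity behaviour: exactly one of them is π and
the other vanishes. Independence of n is what later sums the density against 1 + t to the value
g(r). -/
theorem integral_one_add_cos_mul_chebU (n : ℕ) :
    ∫ θ in (0 : ℝ)..Real.pi, (1 + Real.cos θ) * chebU n θ = Real.pi := by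
  have hc := continuous_chebU n
  have hi : IntervalIntegrable (fun θ => Real.cos θ * chebU n θ) volume 0 Real.pi :=
    (Real.continuous_cos.mul hc).intervalIntegrable _ _
  simp_rw [add_mul, one_mul]
  rw [intervalIntegral.integral_add (hc.intervalIntegrable _ _) hi, integral_cos_mul_chebU,
    integral_chebU, integral_chebU, pow_succ]
  ring

theorem integral_one_sub_cos_mul_chebU (n : ℕ) :
    ∫ θ in (0 : ℝ)..Real.pi, (1 - Real.cos θ) * chebU n θ = Real.pi * (-1) ^ n := by
  have hc := continuous_chebU n
  have hi : IntervalIntegrable (fun θ => Real.cos θ * chebU n θ) volume 0 Real.pi :=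
    (Real.continuous_cos.mul hc).intervalIntegrable _ _
  simp_rw [sub_mul, one_mul]
  rw [intervalIntegral.integral_sub (hc.intervalIntegrable _ _) hi, integral_cos_mul_chebU,
    integral_chebU, integral_chebU, pow_succ]
  ring

theorem integral_chebU_mul_chebU (m n : ℕ) :
    ∫ θ in (0 : ℝ)..Real.pi, 2 * (1 - Real.cos θ ^ 2) * chebU m θ * chebU n θ =
      if n = m then Real.pi else 0 := by
  have h : ∀ θ : ℝ, 2 * (1 - Real.cos θ ^ 2) * chebU m θ * chebU n θ =
      Real.cos (((m - n : ℤ) : ℝ) * θ) - Real.cos (((m + n + 2 : ℤ) : ℝ) * θ) := by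
    intro θ
    have e1 : ((m - n : ℤ) : ℝ) * θ = (m + 1) * θ - (n + 1) * θ := by push_cast; ring
    have e2 : ((m + n + 2 : ℤ) : ℝ) * θ = (m + 1) * θ + (n + 1) * θ := by push_cast; ring
    rw [e1, e2, Real.cos_sub, Real.cos_add, ← chebU_mul_sin, ← chebU_mul_sin, ← Real.sin_sq]
    ring
  simp_rw [h]
  rw [intervalIntegral.integral_sub, integral_cos_int_mul (k := (m + n + 2 : ℤ)) (by positivity),
    sub_zero]
  · split_ifs with hnm
    · subst hnm; simp
    · exact integral_cos_int_mul (by omega)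
  · exact (by fun_prop : Continuous fun θ : ℝ =>
      Real.cos (((m - n : ℤ) : ℝ) * θ)).intervalIntegrable _ _
  · exact (by fun_prop : Continuous fun θ : ℝ =>
      Real.cos (((m + n + 2 : ℤ) : ℝ) * θ)).intervalIntegrable _ _

end ChebyshevPolynomials

/-! ### Positive linear maps on C([-1, 1]) and the Schwarz inequality -/

section PositiveRepresentations

variable {N : Type*} [NormedAddCommGroup N] [InnerProductSpace ℂ N]

/-- The cosine as a map into `[-1, 1]`. -/
def cosIcc : C(ℝ, Set.Icc (-1 : ℝ) 1) :=
  ⟨fun θ => ⟨Real.cos θ, Real.neg_one_le_cos θ, Real.cos_le_one θ⟩,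
    Real.continuous_cos.subtype_mk _⟩

@[simp] theorem coe_cosIcc (θ : ℝ) : (cosIcc θ : ℝ) = Real.cos θ := rfl

theorem continuous_comp_cosIcc_smul {M : ℝ → N →L[ℂ] N} (hM : Continuous M)
    (φ : C(Set.Icc (-1 : ℝ) 1, ℂ)) : Continuous fun θ => φ (cosIcc θ) • M θ :=
  (φ.continuous.comp cosIcc.continuous).smul hM

/-- Integration of continuous functions of `cos θ` against an operator density on `[0, π]`. -/
def integralRep (M : ℝ → N →L[ℂ] N) (hM : Continuous M) :
    C(Set.Icc (-1 : ℝ) 1, ℂ) →ₗ[ℂ] (N →L[ℂ] N) where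
  toFun φ := (Real.pi⁻¹ : ℂ) • ∫ θ in (0 : ℝ)..Real.pi, φ (cosIcc θ) • M θ
  map_add' φ ψ := by
    simp only [ContinuousMap.add_apply, add_smul]
    rw [intervalIntegral.integral_add, smul_add]
    · exact (continuous_comp_cosIcc_smul hM φ).intervalIntegrable _ _
    · exact (continuous_comp_cosIcc_smul hM ψ).intervalIntegrable _ _
  map_smul' c φ := by
    simp only [ContinuousMap.smul_apply, smul_eq_mul, mul_smul, RingHom.id_apply]
    rw [intervalIntegral.integral_smul, smul_comm]

theorem continuous_inner_density {M : ℝ → N →L[ℂ] N} (hM : Continuous M)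
    (φ : C(Set.Icc (-1 : ℝ) 1, ℂ)) (f g : N) :
    Continuous fun θ => φ (cosIcc θ) * inner ℂ g (M θ f) :=
  (φ.continuous.comp cosIcc.continuous).mul (continuous_const.inner (hM.clm_apply continuous_const))

variable [CompleteSpace N]

/-- A `*`-preserving, positive and contractively Schwarz linear map from the continuous functions
on `[-1, 1]` to the bounded operators. -/
structure IsPositiveRep (T : C(Set.Icc (-1 : ℝ) 1, ℂ) →ₗ[ℂ] (N →L[ℂ] N)) : Prop where
  map_star : ∀ φ, T (star φ) = star (T φ)
  re_nonneg : ∀ φ, (∀ t, 0 ≤ (φ t).re) → ∀ f, 0 ≤ (inner ℂ f (T φ f)).re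
  two_re_le : ∀ φ f g, 2 * (inner ℂ g (T φ f)).re ≤
    (inner ℂ f (T (star φ * φ) f)).re + (inner ℂ g (T 1 g)).re

theorem inner_integralRep (M : ℝ → N →L[ℂ] N) (hM : Continuous M)
    (φ : C(Set.Icc (-1 : ℝ) 1, ℂ)) (f g : N) :
    inner ℂ g (integralRep M hM φ f) =
      (Real.pi⁻¹ : ℂ) * ∫ θ in (0 : ℝ)..Real.pi, φ (cosIcc θ) * inner ℂ g (M θ f) := by
  have h := ((innerSL ℂ g) ∘L (ContinuousLinearMap.apply ℂ N f)).intervalIntegral_comp_comm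
    (μ := volume) ((continuous_comp_cosIcc_smul hM φ).intervalIntegrable 0 Real.pi)
  simp only [ContinuousLinearMap.comp_apply, ContinuousLinearMap.apply_apply, innerSL_apply_apply,
    _root_.smul_apply, inner_smul_right] at h
  rw [h]
  simp [integralRep]

theorem re_inner_integralRep (M : ℝ → N →L[ℂ] N) (hM : Continuous M)
    (φ : C(Set.Icc (-1 : ℝ) 1, ℂ)) (f g : N) :
    (inner ℂ g (integralRep M hM φ f)).re =
      Real.pi⁻¹ * ∫ θ in (0 : ℝ)..Real.pi, (φ (cosIcc θ) * inner ℂ g (M θ f)).re := by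
  have h := Complex.reCLM.intervalIntegral_comp_comm
    (μ := volume) ((continuous_inner_density hM φ f g).intervalIntegrable 0 Real.pi)
  simp only [Complex.reCLM_apply] at h
  rw [h, inner_integralRep, ← Complex.ofReal_inv, Complex.re_ofReal_mul]

theorem inner_adjoint_swap {A : N →L[ℂ] N} (hA : star A = A) (f g : N) :
    inner ℂ g (A f) = (starRingEnd ℂ) (inner ℂ f (A g)) := by
  conv_lhs => rw [← hA]
  rw [ContinuousLinearMap.star_eq_adjoint, ContinuousLinearMap.adjoint_inner_right,
    inner_conj_symm]

/-- All three properties hold pointwise for the density and survive integration. The Schwarz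
inequality is kept in polarised form, with a free test vector g, so that it also survives strong
limits. -/
theorem isPositiveRep_integralRep (M : ℝ → N →L[ℂ] N) (hM : Continuous M)
    (hs : ∀ θ, star (M θ) = M θ)
    (hp : ∀ θ ∈ Set.Icc 0 Real.pi, ∀ f, 0 ≤ (inner ℂ f (M θ f)).re) :
    IsPositiveRep (integralRep M hM) where
  map_star φ := by
    ext f
    refine ext_inner_left ℂ fun g => ?_
    rw [ContinuousLinearMap.star_eq_adjoint, ContinuousLinearMap.adjoint_inner_right,
      ← inner_conj_symm (integralRep M hM φ g), inner_integralRep, inner_integralRep, map_mul,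
      ← intervalIntegral.intervalIntegral_conj]
    congr 1
    · simp
    · refine intervalIntegral.integral_congr fun θ _ => ?_
      simp only [map_mul]
      rw [← inner_adjoint_swap (hs θ)]
      rfl
  re_nonneg φ hφ f := by
    rw [re_inner_integralRep]
    refine mul_nonneg (inv_nonneg.2 Real.pi_pos.le)
      (intervalIntegral.integral_nonneg Real.pi_pos.le fun θ hθ => ?_)
    have him : (inner ℂ f (M θ f)).im = 0 := by
      have := congrArg Complex.im (inner_adjoint_swap (hs θ) f f)
      simp only [Complex.conj_im] at this
      linarith
    rw [Complex.mul_re, him, mul_zero, sub_zero]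
    exact mul_nonneg (hφ _) (hp θ hθ f)
  two_re_le φ f g := by
    rw [re_inner_integralRep, re_inner_integralRep, re_inner_integralRep]
    have hc : ∀ (ψ : C(Set.Icc (-1 : ℝ) 1, ℂ)) (f g : N), IntervalIntegrable
        (fun θ => (ψ (cosIcc θ) * inner ℂ g (M θ f)).re) volume 0 Real.pi := fun ψ f g =>
      (Complex.continuous_re.comp (continuous_inner_density hM ψ f g)).intervalIntegrable _ _
    rw [← mul_add, ← intervalIntegral.integral_add (hc _ _ _) (hc _ _ _), mul_left_comm,
      ← intervalIntegral.integral_const_mul]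
    refine mul_le_mul_of_nonneg_left ?_ (inv_nonneg.2 Real.pi_pos.le)
    refine intervalIntegral.integral_mono_on Real.pi_pos.le ((hc _ _ _).const_mul _)
      ((hc _ _ _).add (hc _ _ _)) fun θ hθ => ?_
    -- Expanding the nonnegative form of M(θ) at φf - g gives the polarised inequality for the
    -- integrand.
    have h := hp θ hθ (φ (cosIcc θ) • f - g)
    have hsw := inner_adjoint_swap (hs θ) g f
    simp only [map_sub, map_smul, inner_sub_left, inner_sub_right, inner_smul_left,
      inner_smul_right, hsw, Complex.sub_re] at h
    have e : ((starRingEnd ℂ) (φ (cosIcc θ)) * (starRingEnd ℂ) (inner ℂ g (M θ f))).re =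
        (φ (cosIcc θ) * inner ℂ g (M θ f)).re := by rw [← map_mul, Complex.conj_re]
    rw [e] at h
    simp only [ContinuousMap.mul_apply, ContinuousMap.star_apply, ContinuousMap.one_apply, one_mul,
      Complex.star_def, mul_assoc]
    rw [mul_sub, Complex.sub_re, mul_left_comm] at h
    linarith

namespace IsPositiveRep

variable {T : C(Set.Icc (-1 : ℝ) 1, ℂ) →ₗ[ℂ] (N →L[ℂ] N)}

theorem re_inner_mono (hT : IsPositiveRep T) {φ ψ : C(Set.Icc (-1 : ℝ) 1, ℂ)}
    (h : ∀ t, (φ t).re ≤ (ψ t).re) (f : N) :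
    (inner ℂ f (T φ f)).re ≤ (inner ℂ f (T ψ f)).re := by
  have := hT.re_nonneg (ψ - φ) (fun t => by simpa using h t) f
  simpa [inner_sub_right] using this

theorem star_map_one (hT : IsPositiveRep T) : star (T 1) = T 1 := by
  rw [← hT.map_star, star_one]

theorem re_inner_star_mul_le (hT : IsPositiveRep T) (φ : C(Set.Icc (-1 : ℝ) 1, ℂ)) (f : N) :
    (inner ℂ f (T (star φ * φ) f)).re ≤ ‖φ‖ ^ 2 * (inner ℂ f (T 1 f)).re := by
  have h := hT.re_inner_mono (φ := star φ * φ) (ψ := ((‖φ‖ ^ 2 : ℝ) : ℂ) • 1) (fun t => by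
    have h1 := φ.norm_coe_le_norm t
    have : ((star φ * φ) t) = ((‖φ t‖ ^ 2 : ℝ) : ℂ) := by
      simp [Complex.conj_mul']
    rw [this]
    simp only [ContinuousMap.smul_apply, ContinuousMap.one_apply, smul_eq_mul, mul_one,
      Complex.ofReal_re]
    gcongr) f
  simpa only [map_smul, _root_.smul_apply, inner_smul_right, Complex.re_ofReal_mul]
    using h

theorem norm_apply_le (hT : IsPositiveRep T) {C : ℝ} (hC : 0 < C) (h1 : ‖T 1‖ ≤ C)
    (φ : C(Set.Icc (-1 : ℝ) 1, ℂ)) (f : N) : ‖T φ f‖ ≤ C * ‖φ‖ * ‖f‖ := by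
  have hb : ∀ f : N, (inner ℂ f (T 1 f)).re ≤ C * ‖f‖ ^ 2 := fun f => by
    calc (inner ℂ f (T 1 f)).re ≤ ‖inner ℂ f (T 1 f)‖ := Complex.re_le_norm _
      _ ≤ ‖f‖ * ‖T 1 f‖ := norm_inner_le_norm _ _
      _ ≤ ‖f‖ * (C * ‖f‖) := by
        gcongr
        exact (T 1).le_of_opNorm_le h1 f
      _ = _ := by ring
  -- The factor C⁻¹ is the optimal scaling of the test vector when T 1 is bounded by C.
  have h := hT.two_re_le φ f ((C⁻¹ : ℂ) • T φ f)
  have h2 := hT.re_inner_star_mul_le φ f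
  have h3 := hb ((C⁻¹ : ℂ) • T φ f)
  have h4 := mul_le_mul_of_nonneg_left (hb f) (sq_nonneg ‖φ‖)
  rw [inner_smul_left, ← Complex.ofReal_inv, Complex.conj_ofReal, Complex.re_ofReal_mul,
    inner_self_eq_norm_sq_to_K] at h
  rw [norm_smul, ← Complex.ofReal_inv, Complex.norm_real, Real.norm_of_nonneg (by positivity)] at h3
  have h5 : ((‖T φ f‖ : ℂ) ^ 2).re = ‖T φ f‖ ^ 2 := by norm_cast
  have h6 : 2 * (C⁻¹ * ‖T φ f‖ ^ 2) ≤ ‖φ‖ ^ 2 * (C * ‖f‖ ^ 2) + C * (C⁻¹ * ‖T φ f‖) ^ 2 := by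
    have : (2 : ℝ) * (C⁻¹ * ‖T φ f‖ ^ 2) = 2 * (C⁻¹ * ((‖T φ f‖ : ℂ) ^ 2).re) := by rw [h5]
    rw [this]
    exact h.trans (add_le_add (h2.trans h4) h3)
  have h7 : C * (C⁻¹ * ‖T φ f‖) ^ 2 = C⁻¹ * ‖T φ f‖ ^ 2 := by field_simp
  rw [h7] at h6
  have h8 : C⁻¹ * ‖T φ f‖ ^ 2 ≤ ‖φ‖ ^ 2 * (C * ‖f‖ ^ 2) := by linarith
  rw [inv_mul_le_iff₀ hC] at h8
  refine le_of_sq_le_sq ?_ (by positivity)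
  calc _ ≤ _ := h8
    _ = _ := by ring

theorem inner_map_one_nonneg (hT : IsPositiveRep T) (f : N) : 0 ≤ (inner ℂ f (T 1 f)).re :=
  hT.re_nonneg 1 (fun t => by simp) f

end IsPositiveRep

end PositiveRepresentations

/-! ### Strong limits of positive maps, tested on Chebyshev differences -/

section StrongLimits

/-- The coordinate function on `[-1, 1]`. -/
def coordFun : C(Set.Icc (-1 : ℝ) 1, ℂ) :=
  ⟨fun t => ((t : ℝ) : ℂ), Complex.continuous_ofReal.comp continuous_subtype_val⟩

@[simp] theorem coordFun_apply (t : Set.Icc (-1 : ℝ) 1) : coordFun t = ((t : ℝ) : ℂ) := rfl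

theorem star_coordFun : star coordFun = coordFun := by
  ext t
  simp

/-- The functions `2 (1 - t²) Uₙ(t) = Tₙ(t) - Tₙ₊₂(t)` on `[-1, 1]`. -/
def chebDiff (n : ℕ) : C(Set.Icc (-1 : ℝ) 1, ℂ) :=
  Polynomial.aeval coordFun
    (Polynomial.Chebyshev.T ℂ n - Polynomial.Chebyshev.T ℂ (n + 2))

theorem aeval_coordFun_apply (p : Polynomial ℂ) (t : Set.Icc (-1 : ℝ) 1) :
    (Polynomial.aeval coordFun p : C(Set.Icc (-1 : ℝ) 1, ℂ)) t = p.eval ((t : ℝ) : ℂ) := by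
  rw [Polynomial.aeval_continuousMap_apply, coordFun_apply]

theorem chebDiff_apply (n : ℕ) (t : Set.Icc (-1 : ℝ) 1) :
    chebDiff n t = 2 * (1 - ((t : ℝ) : ℂ) ^ 2) *
      (Polynomial.Chebyshev.U ℂ n).eval ((t : ℝ) : ℂ) := by
  have h1 := congrArg (Polynomial.eval ((t : ℝ) : ℂ))
    (Polynomial.Chebyshev.T_eq_X_mul_T_sub_pol_U ℂ (n : ℤ))
  have h2 := congrArg (Polynomial.eval ((t : ℝ) : ℂ))
    (Polynomial.Chebyshev.T_add_two ℂ (n : ℤ))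
  rw [chebDiff, aeval_coordFun_apply]
  simp only [Polynomial.eval_sub, Polynomial.eval_mul, Polynomial.eval_X, Polynomial.eval_one,
    Polynomial.eval_pow, Polynomial.eval_ofNat] at *
  linear_combination (-2 : ℂ) * h1 + h2

theorem chebDiff_cosIcc (n : ℕ) (θ : ℝ) :
    chebDiff n (cosIcc θ) = ((2 * (1 - Real.cos θ ^ 2) * chebU n θ : ℝ) : ℂ) := by
  rw [chebDiff_apply, coe_cosIcc, ← Polynomial.Chebyshev.complex_ofReal_eval_U]
  simp [chebU]

theorem span_chebyshev_T_eq_top :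
    Submodule.span ℂ (Set.range fun n : ℕ => Polynomial.Chebyshev.T ℂ n) = ⊤ := by
  set V := Submodule.span ℂ (Set.range fun n : ℕ => Polynomial.Chebyshev.T ℂ n) with hV
  have hmem : ∀ n : ℕ, Polynomial.Chebyshev.T ℂ n ∈ V := fun n =>
    Submodule.subset_span ⟨n, rfl⟩
  have hX : ∀ p ∈ V, Polynomial.X * p ∈ V := by
    intro p hp
    refine Submodule.span_induction (p := fun p _ => Polynomial.X * p ∈ V) ?_ (by simp) ?_ ?_ hp
    · rintro _ ⟨n, rfl⟩
      rcases n with _ | n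
      · simpa using hmem 1
      · have h := Polynomial.Chebyshev.T_add_two ℂ (n : ℤ)
        have e : Polynomial.X * Polynomial.Chebyshev.T ℂ ((n + 1 : ℕ) : ℤ) =
            (1 / 2 : ℂ) • (Polynomial.Chebyshev.T ℂ ((n + 2 : ℕ) : ℤ) +
              Polynomial.Chebyshev.T ℂ (n : ℤ)) := by
          push_cast
          rw [h, sub_add_cancel, mul_assoc, two_mul, ← two_smul ℂ, smul_smul]
          norm_num
        rw [e]
        exact V.smul_mem _ (V.add_mem (hmem _) (hmem _))
    · intro p q _ _ hp hq
      rw [mul_add]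
      exact V.add_mem hp hq
    · intro c p _ hp
      rw [mul_smul_comm]
      exact V.smul_mem _ hp
  have hpow : ∀ n : ℕ, (Polynomial.X : Polynomial ℂ) ^ n ∈ V := by
    intro n
    induction n with
    | zero => simpa using hmem 0
    | succ n ih => rw [pow_succ']; exact hX _ ih
  refine eq_top_iff.2 fun p _ => ?_
  rw [p.as_sum_range_C_mul_X_pow]
  refine Submodule.sum_mem _ fun i _ => ?_
  rw [← Polynomial.smul_eq_C_mul]
  exact V.smul_mem _ (hpow i)

theorem dense_range_aeval_coordFun :
    Dense (Set.range fun p : Polynomial ℂ =>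
      (Polynomial.aeval coordFun p : C(Set.Icc (-1 : ℝ) 1, ℂ))) := by
  have hS : (StarAlgebra.adjoin ℂ {coordFun}).topologicalClosure = ⊤ := by
    refine ContinuousMap.starSubalgebra_topologicalClosure_eq_top_of_separatesPoints _ ?_
    intro x y hxy
    refine ⟨coordFun, ⟨coordFun, StarAlgebra.self_mem_adjoin_singleton _ _, rfl⟩, ?_⟩
    simpa [Subtype.ext_iff] using hxy
  have hset : (StarAlgebra.adjoin ℂ {coordFun} : Set C(Set.Icc (-1 : ℝ) 1, ℂ)) =
      Set.range fun p : Polynomial ℂ => Polynomial.aeval coordFun p := by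
    have h1 : (StarAlgebra.adjoin ℂ {coordFun}).toSubalgebra = Algebra.adjoin ℂ {coordFun} := by
      rw [StarAlgebra.adjoin_toSubalgebra, Set.star_singleton, star_coordFun, Set.union_self]
    rw [← StarSubalgebra.coe_toSubalgebra, h1, Algebra.adjoin_singleton_eq_range_aeval]
    rfl
  rw [← hset]
  intro φ
  have : φ ∈ (StarAlgebra.adjoin ℂ {coordFun}).topologicalClosure := hS ▸ trivial
  exact this

variable {N : Type*} [NormedAddCommGroup N] [InnerProductSpace ℂ N] [CompleteSpace N]

/-- Convergence on 1 bounds T_k(1) by Banach–Steinhaus, and positivity turns this into a bound for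
T_k uniform in k. From 1, t and T_n - T_{n+2} one reaches every T_n by steps of two, hence every
polynomial; density of the polynomials and the uniform bound do the rest. -/
theorem exists_tendsto_of_chebDiff {T : ℕ → C(Set.Icc (-1 : ℝ) 1, ℂ) →ₗ[ℂ] (N →L[ℂ] N)}
    (hT : ∀ k, IsPositiveRep (T k))
    (h1 : ∀ f, ∃ y, Tendsto (fun k => T k 1 f) atTop (𝓝 y))
    (hX : ∀ f, ∃ y, Tendsto (fun k => T k coordFun f) atTop (𝓝 y))
    (hD : ∀ n f, ∃ y, Tendsto (fun k => T k (chebDiff n) f) atTop (𝓝 y)) :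
    ∃ C : ℝ, 0 < C ∧ (∀ k φ f, ‖T k φ f‖ ≤ C * ‖φ‖ * ‖f‖) ∧
      ∀ φ f, ∃ y, Tendsto (fun k => T k φ f) atTop (𝓝 y) := by
  obtain ⟨C₀, hC₀⟩ := banach_steinhaus (g := fun k => T k 1) (fun f => by
    obtain ⟨y, hy⟩ := h1 f
    obtain ⟨B, hB⟩ := (Metric.isBounded_range_of_tendsto _ hy).exists_norm_le
    exact ⟨B, fun k => hB _ ⟨k, rfl⟩⟩)
  set C := max C₀ 1
  have hC : 0 < C := lt_max_of_lt_right one_pos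
  have hb : ∀ k φ f, ‖T k φ f‖ ≤ C * ‖φ‖ * ‖f‖ := fun k φ f =>
    (hT k).norm_apply_le hC ((hC₀ k).trans (le_max_left _ _)) φ f
  refine ⟨C, hC, hb, ?_⟩
  let S : Submodule ℂ (Polynomial ℂ) :=
    { carrier := {p | ∀ f, ∃ y, Tendsto (fun k => T k (Polynomial.aeval coordFun p) f) atTop (𝓝 y)}
      add_mem' := fun {p q} hp hq f => by
        obtain ⟨y, hy⟩ := hp f
        obtain ⟨z, hz⟩ := hq f
        exact ⟨y + z, by simpa using hy.add hz⟩
      zero_mem' := fun f => ⟨0, by simp⟩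
      smul_mem' := fun c p hp f => by
        obtain ⟨y, hy⟩ := hp f
        exact ⟨c • y, by simpa using hy.const_smul c⟩ }
  have hS : S = ⊤ := by
    refine top_unique ?_
    rw [← span_chebyshev_T_eq_top, Submodule.span_le]
    rintro _ ⟨n, rfl⟩
    change Polynomial.Chebyshev.T ℂ n ∈ S
    induction n using Nat.twoStepInduction with
    | zero => intro f; simpa using h1 f
    | one => intro f; simpa using hX f
    | more n ih _ =>
      have hd : Polynomial.Chebyshev.T ℂ n - Polynomial.Chebyshev.T ℂ (n + 2) ∈ S := hD n
      have := S.sub_mem ih hd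
      simpa using this
  intro φ f
  refine cauchySeq_tendsto_of_complete ?_
  rw [Metric.cauchySeq_iff']
  intro ε hε
  have hδ : 0 < ε / (3 * C * (‖f‖ + 1)) := by positivity
  obtain ⟨_, ⟨p, rfl⟩, hp⟩ := dense_range_aeval_coordFun.exists_dist_lt φ hδ
  have hpS : p ∈ S := hS ▸ trivial
  obtain ⟨y, hy⟩ := hpS f
  obtain ⟨n₀, hn₀⟩ := Metric.cauchySeq_iff'.1 hy.cauchySeq (ε / 3) (by positivity)
  refine ⟨n₀, fun n hn => ?_⟩
  set ψ : C(Set.Icc (-1 : ℝ) 1, ℂ) := Polynomial.aeval coordFun p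
  have key : ∀ k, dist (T k φ f) (T k ψ f) < ε / 3 := fun k => by
    have h := hb k (φ - ψ) f
    rw [map_sub, _root_.sub_apply, ← dist_eq_norm, ← dist_eq_norm] at h
    refine h.trans_lt ?_
    calc C * dist φ ψ * ‖f‖ ≤ C * dist φ ψ * (‖f‖ + 1) := by gcongr; linarith
      _ < C * (ε / (3 * C * (‖f‖ + 1))) * (‖f‖ + 1) := by gcongr
      _ = ε / 3 := by field_simp
  calc dist (T n φ f) (T n₀ φ f)
      ≤ dist (T n φ f) (T n ψ f) + dist (T n ψ f) (T n₀ ψ f) + dist (T n₀ ψ f) (T n₀ φ f) :=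
        dist_triangle4 _ _ _ _
    _ < ε / 3 + ε / 3 + ε / 3 := by
        gcongr
        · exact key n
        · exact hn₀ n hn
        · rw [dist_comm]; exact key n₀
    _ = ε := by ring

/-- The strong limit of a sequence of positive representations. -/
theorem exists_isPositiveRep_tendsto
    {T : ℕ → C(Set.Icc (-1 : ℝ) 1, ℂ) →ₗ[ℂ] (N →L[ℂ] N)} (hT : ∀ k, IsPositiveRep (T k))
    (h1 : ∀ f, ∃ y, Tendsto (fun k => T k 1 f) atTop (𝓝 y))
    (hX : ∀ f, ∃ y, Tendsto (fun k => T k coordFun f) atTop (𝓝 y))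
    (hD : ∀ n f, ∃ y, Tendsto (fun k => T k (chebDiff n) f) atTop (𝓝 y)) :
    ∃ S : C(Set.Icc (-1 : ℝ) 1, ℂ) →ₗ[ℂ] (N →L[ℂ] N), IsPositiveRep S ∧
      ∀ φ f, Tendsto (fun k => T k φ f) atTop (𝓝 (S φ f)) := by
  obtain ⟨C, hC, hb, hlim⟩ := exists_tendsto_of_chebDiff hT h1 hX hD
  choose L hL using hlim
  let S : C(Set.Icc (-1 : ℝ) 1, ℂ) →ₗ[ℂ] (N →L[ℂ] N) :=
    { toFun := fun φ => LinearMap.mkContinuous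
        { toFun := L φ
          map_add' := fun f g => tendsto_nhds_unique (hL φ (f + g))
            (by simpa using (hL φ f).add (hL φ g))
          map_smul' := fun c f => tendsto_nhds_unique (hL φ (c • f))
            (by simpa using (hL φ f).const_smul c) }
        (C * ‖φ‖) (fun f => le_of_tendsto (hL φ f).norm (Eventually.of_forall fun k => hb k φ f))
      map_add' := fun φ ψ => by
        ext f
        exact tendsto_nhds_unique (hL (φ + ψ) f) (by simpa using (hL φ f).add (hL ψ f))
      map_smul' := fun c φ => by
        ext f
        exact tendsto_nhds_unique (hL (c • φ) f) (by simpa using (hL φ f).const_smul c) }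
  have hS : ∀ φ f, Tendsto (fun k => T k φ f) atTop (𝓝 (S φ f)) := hL
  have hre : ∀ φ f g, Tendsto (fun k => (inner ℂ g (T k φ f)).re) atTop
      (𝓝 (inner ℂ g (S φ f)).re) := fun φ f g =>
    (Complex.continuous_re.tendsto _).comp (tendsto_const_nhds.inner (hS φ f))
  refine ⟨S, ⟨fun φ => ?_, fun φ hφ f => ?_, fun φ f g => ?_⟩, hS⟩
  · ext f
    refine ext_inner_left ℂ fun g => ?_
    rw [ContinuousLinearMap.star_eq_adjoint, ContinuousLinearMap.adjoint_inner_right]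
    refine tendsto_nhds_unique (tendsto_const_nhds.inner (hS (star φ) f)) ?_
    refine ((hS φ g).inner tendsto_const_nhds).congr fun k => ?_
    rw [(hT k).map_star, ContinuousLinearMap.star_eq_adjoint,
      ContinuousLinearMap.adjoint_inner_right]
  · exact ge_of_tendsto' (hre φ f f) fun k => (hT k).re_nonneg φ hφ f
  · exact le_of_tendsto_of_tendsto' ((hre φ f g).const_mul 2)
      ((hre (star φ * φ) f f).add (hre 1 g g)) fun k => (hT k).two_re_le φ f g

end StrongLimits

/-! ### The conformal map of the disk onto the slit plane -/

section DiskMap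

/-- The conformal map `ζ ↦ 2ζ / (1 + ζ²)` of the unit disk onto `extDomain`. -/
def diskMap (ζ : ℂ) : ℂ := 2 * ζ / (1 + ζ ^ 2)

theorem one_add_sq_ne_zero {ζ : ℂ} (h : ‖ζ‖ < 1) : 1 + ζ ^ 2 ≠ 0 := by
  intro h0
  have h1 : ‖ζ ^ 2‖ = 1 := by
    rw [show ζ ^ 2 = -1 by linear_combination h0]; simp
  rw [norm_pow] at h1
  nlinarith [norm_nonneg ζ]

theorem diskMap_conj (ζ : ℂ) :
    diskMap ((starRingEnd ℂ) ζ) = (starRingEnd ℂ) (diskMap ζ) := by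
  simp only [diskMap, map_div₀, map_mul, map_add, map_pow, map_one, map_ofNat]

theorem diskMap_im {ζ : ℂ} :
    (diskMap ζ).im = 2 * ζ.im * (1 - ‖ζ‖ ^ 2) / Complex.normSq (1 + ζ ^ 2) := by
  rw [diskMap, Complex.div_im, Complex.sq_norm]
  simp only [Complex.normSq_apply, pow_two, Complex.add_re, Complex.add_im, Complex.mul_re,
    Complex.mul_im, Complex.one_re, Complex.one_im, Complex.re_ofNat, Complex.im_ofNat]
  ring

theorem diskMap_im_pos {ζ : ℂ} (h : ‖ζ‖ < 1) (hi : 0 < ζ.im) : 0 < (diskMap ζ).im := by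
  rw [diskMap_im]
  have := Complex.normSq_pos.2 (one_add_sq_ne_zero h)
  have h2 : 0 < 1 - ‖ζ‖ ^ 2 := by nlinarith [norm_nonneg ζ]
  positivity

theorem diskMap_ofReal (x : ℝ) : diskMap x = ((2 * x / (1 + x ^ 2) : ℝ) : ℂ) := by
  simp [diskMap]

theorem abs_real_diskMap_lt {x : ℝ} (hx : |x| < 1) : |2 * x / (1 + x ^ 2)| < 1 := by
  rw [abs_div, div_lt_one (by positivity), abs_mul, abs_two, abs_of_pos (show (0 : ℝ) < 1 + x ^ 2 by positivity)]
  nlinarith [sq_abs x, pow_pos (sub_pos.2 hx) 2]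

theorem diskMap_mem_extDomain {ζ : ℂ} (h : ‖ζ‖ < 1) : diskMap ζ ∈ extDomain := by
  rintro ⟨h1, h2⟩
  have h3 : 0 < 1 - ‖ζ‖ ^ 2 := by nlinarith [norm_nonneg ζ]
  have h4 := Complex.normSq_pos.2 (one_add_sq_ne_zero h)
  have h5 : ζ.im = 0 := by
    rw [diskMap_im, div_eq_zero_iff] at h1
    rcases h1 with h1 | h1
    · rcases mul_eq_zero.1 h1 with h1 | h1
      · linarith
      · linarith
    · linarith
  obtain ⟨x, rfl⟩ : ∃ x : ℝ, ζ = x := ⟨ζ.re, Complex.ext (by simp) (by simp [h5])⟩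
  rw [diskMap_ofReal, Complex.ofReal_re] at h2
  have h6 := abs_lt.1 (abs_real_diskMap_lt (x := x) (by simpa using h))
  rcases h2 with h2 | h2 <;> linarith

/-- The equation zζ² - 2ζ + z = 0 has two roots with product 1. If neither lies in the disk, both
are unimodular and conjugate to each other; their sum 2/z is then real of modulus at most 2, which
places z on a slit. -/
theorem exists_diskMap_eq {z : ℂ} (hz : z ∈ extDomain) : ∃ ζ : ℂ, ‖ζ‖ < 1 ∧ diskMap ζ = z := by
  rcases eq_or_ne z 0 with rfl | h0
  · exact ⟨0, by simp, by simp [diskMap]⟩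
  obtain ⟨s, hs⟩ := IsAlgClosed.exists_pow_nat_eq (1 - z ^ 2) two_pos
  have hroot : ∀ ζ : ℂ, z * ζ ^ 2 - 2 * ζ + z = 0 → ‖ζ‖ < 1 → diskMap ζ = z := by
    intro ζ h1 h2
    rw [diskMap, div_eq_iff (one_add_sq_ne_zero h2)]
    linear_combination -h1
  have h1 : z * ((1 - s) / z) ^ 2 - 2 * ((1 - s) / z) + z = 0 := by
    field_simp
    linear_combination hs
  have h2 : z * ((1 + s) / z) ^ 2 - 2 * ((1 + s) / z) + z = 0 := by
    field_simp
    linear_combination hs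
  have hprod : (1 - s) / z * ((1 + s) / z) = 1 := by
    field_simp
    linear_combination -hs
  by_cases hlt : ‖(1 - s) / z‖ < 1
  · exact ⟨_, hlt, hroot _ h1 hlt⟩
  by_cases hlt' : ‖(1 + s) / z‖ < 1
  · exact ⟨_, hlt', hroot _ h2 hlt'⟩
  exfalso
  push Not at hlt hlt'
  set a := (1 - s) / z with ha
  have hab := congrArg norm hprod
  rw [norm_mul, norm_one] at hab
  have hn : ‖a‖ = 1 := by nlinarith
  have hconj : (1 + s) / z = (starRingEnd ℂ) a := by
    have : a * (starRingEnd ℂ) a = 1 := by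
      rw [Complex.mul_conj, Complex.normSq_eq_norm_sq, hn]; simp
    have ha0 : a ≠ 0 := by
      rintro h; rw [h] at hn; simp at hn
    exact mul_left_cancel₀ ha0 (hprod.trans this.symm)
  have hsum : z * (a.re : ℂ) = 1 := by
    have : a + (starRingEnd ℂ) a = 2 / z := by
      rw [← hconj, ha]; ring
    rw [Complex.add_conj] at this
    field_simp at this
    push_cast at this
    linear_combination this / 2
  have hre : |a.re| ≤ 1 := hn ▸ Complex.abs_re_le_norm a
  have hz' : z = ((a.re⁻¹ : ℝ) : ℂ) := by
    rw [Complex.ofReal_inv]; exact eq_inv_of_mul_eq_one_left hsum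
  have ha0 : a.re ≠ 0 := by
    intro h; rw [h] at hsum; simp at hsum
  refine hz ?_
  rw [hz']
  refine ⟨Complex.ofReal_im _, ?_⟩
  rw [Complex.ofReal_re]
  rcases lt_or_gt_of_ne ha0 with hneg | hpos
  · left
    have := abs_le.1 hre
    rw [inv_le_of_neg hneg (by norm_num)]
    linarith
  · right
    exact (one_le_inv₀ hpos).2 (abs_le.1 hre).2

theorem isOpen_extDomain : IsOpen extDomain := by
  have : IsClosed {z : ℂ | z.im = 0 ∧ (z.re ≤ -1 ∨ 1 ≤ z.re)} :=
    (isClosed_eq Complex.continuous_im continuous_const).inter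
      ((isClosed_le Complex.continuous_re continuous_const).union
        (isClosed_le continuous_const Complex.continuous_re))
  exact this.isOpen_compl

theorem differentiableOn_diskMap : DifferentiableOn ℂ diskMap (Metric.ball 0 1) := by
  intro ζ hζ
  have h := one_add_sq_ne_zero (mem_ball_zero_iff.1 hζ)
  unfold diskMap
  exact DifferentiableAt.differentiableWithinAt (by fun_prop (disch := exact h))

theorem eq_of_hasSum_pow_smul {E : Type*} [NormedAddCommGroup E] [NormedSpace ℂ E]
    {f : ℂ → E} {B B' : ℕ → E}
    (h : ∀ ζ : ℂ, ‖ζ‖ < 1 → HasSum (fun n => ζ ^ n • B n) (f ζ))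
    (h' : ∀ ζ : ℂ, ‖ζ‖ < 1 → HasSum (fun n => ζ ^ n • B' n) (f ζ)) : B = B' := by
  let p : (ℕ → E) → FormalMultilinearSeries ℂ ℂ E := fun B n =>
    ContinuousMultilinearMap.mkPiRing ℂ (Fin n) (B n)
  have hc : ∀ B n, (p B).coeff n = B n := fun B n => by
    simp [p, FormalMultilinearSeries.coeff]
  have key : ∀ B : ℕ → E, (∀ ζ : ℂ, ‖ζ‖ < 1 → HasSum (fun n => ζ ^ n • B n) (f ζ)) →
      HasFPowerSeriesAt f (p B) 0 := fun B hB => by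
    rw [hasFPowerSeriesAt_iff]
    filter_upwards [Metric.ball_mem_nhds (0 : ℂ) one_pos] with ζ hζ
    simpa [hc] using hB ζ (mem_ball_zero_iff.1 hζ)
  have := (key B h).eq_formalMultilinearSeries (key B' h')
  ext n
  rw [← hc B n, this, hc]

variable {N : Type*} [NormedAddCommGroup N] [InnerProductSpace ℂ N] [CompleteSpace N]

/-- The symmetry is assumed only off the real line; continuity carries it to the real points of the
slit plane. -/
theorem IsHerglotzNevanlinna.apply_conj {W : ℂ → N →L[ℂ] N} (hW : IsHerglotzNevanlinna W)
    (hd : DifferentiableOn ℂ W extDomain) {z : ℂ} (hz : z ∈ extDomain) :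
    W ((starRingEnd ℂ) z) = star (W z) := by
  rcases ne_or_eq z.im 0 with h0 | h0
  · exact hW.2.1 z h0
  have hzc : (starRingEnd ℂ) z = z := Complex.conj_eq_iff_im.2 h0
  have hcont : ContinuousAt W z := (hd.differentiableAt (isOpen_extDomain.mem_nhds hz)).continuousAt
  have hpath : Tendsto (fun ε : ℝ => z + ε * I) (𝓝[>] 0) (𝓝 z) := by
    have : ContinuousAt (fun ε : ℝ => z + ε * I) 0 := by fun_prop
    simpa [ContinuousAt] using this.tendsto.mono_left nhdsWithin_le_nhds
  have hpath' : Tendsto (fun ε : ℝ => (starRingEnd ℂ) (z + ε * I)) (𝓝[>] 0) (𝓝 z) := by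
    have := (Complex.continuous_conj.tendsto z).comp hpath
    rwa [hzc] at this
  have e1 := hcont.tendsto.comp hpath'
  have e2 := (continuous_star.tendsto _).comp (hcont.tendsto.comp hpath)
  rw [hzc]
  refine tendsto_nhds_unique (e1.congr' ?_) e2
  filter_upwards [self_mem_nhdsWithin] with ε hε
  refine hW.2.1 _ ?_
  simpa [h0] using (ne_of_gt hε)

/-- The coefficients are selfadjoint because the conformal map commutes with conjugation and Taylor
coefficients are unique. The index is shifted by one since the constant term vanishes. -/
theorem IsHerglotzNevanlinna.exists_hasSum {W : ℂ → N →L[ℂ] N} (hW : IsHerglotzNevanlinna W)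
    (hd : DifferentiableOn ℂ W extDomain) (h0 : W 0 = 0) :
    ∃ A : ℕ → N →L[ℂ] N, (∀ n, star (A n) = A n) ∧
      ∀ ζ : ℂ, ‖ζ‖ < 1 → HasSum (fun n => ζ ^ (n + 1) • A n) (W (diskMap ζ)) := by
  set g : ℂ → N →L[ℂ] N := fun ζ => W (diskMap ζ) with hg
  have hgd : DifferentiableOn ℂ g (Metric.ball 0 1) :=
    hd.comp differentiableOn_diskMap fun ζ hζ => diskMap_mem_extDomain (mem_ball_zero_iff.1 hζ)
  set B : ℕ → N →L[ℂ] N := fun n => (n.factorial : ℂ)⁻¹ • iteratedDeriv n g 0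
  have hB : ∀ ζ : ℂ, ‖ζ‖ < 1 → HasSum (fun n => ζ ^ n • B n) (g ζ) := fun ζ hζ => by
    have := Complex.hasSum_taylorSeries_on_ball hgd (mem_ball_zero_iff.2 hζ)
    refine this.congr_fun ?_
    intro n
    simp only [B, sub_zero]
    rw [smul_comm]
  have hBs : ∀ ζ : ℂ, ‖ζ‖ < 1 → HasSum (fun n => ζ ^ n • star (B n)) (g ζ) := fun ζ hζ => by
    have h := (hB ((starRingEnd ℂ) ζ) (by simpa using hζ)).star
    have e : star (g ((starRingEnd ℂ) ζ)) = g ζ := by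
      simp only [hg, diskMap_conj, hW.apply_conj hd (diskMap_mem_extDomain hζ), star_star]
    rw [e] at h
    simpa [star_smul] using h
  have hBB := eq_of_hasSum_pow_smul hBs hB
  refine ⟨fun n => B (n + 1), fun n => congrFun hBB (n + 1), fun ζ hζ => ?_⟩
  have hB0 : B 0 = 0 := by simp [B, hg, diskMap, h0]
  have := (hasSum_nat_add_iff' (f := fun n => ζ ^ n • B n) 1).2 (hB ζ hζ)
  simpa [hB0] using this

end DiskMap

/-! ### The operator density on circles |ζ| = r and its moments -/

section Densities

variable {N : Type*} [NormedAddCommGroup N] [InnerProductSpace ℂ N]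

/-- The density `∑ rⁿ⁺¹ Uₙ(cos θ) Aₙ`, formally `Im g(r e^{iθ}) / sin θ` for `g(ζ) = ∑ ζⁿ⁺¹ Aₙ`. -/
def chebDensity (A : ℕ → N →L[ℂ] N) (r : ℝ) (θ : ℝ) : N →L[ℂ] N :=
  ∑' n : ℕ, ((r ^ (n + 1) * chebU n θ : ℝ) : ℂ) • A n

/-- The factor n + 1 is the bound for |U_n|; it is absorbed by comparison with a radius strictly
between r and 1. -/
theorem summable_bound_of_hasSum {A : ℕ → N →L[ℂ] N} {g : ℂ → N →L[ℂ] N}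
    (hA : ∀ ζ : ℂ, ‖ζ‖ < 1 → HasSum (fun n => ζ ^ (n + 1) • A n) (g ζ))
    {r : ℝ} (hr0 : 0 < r) (hr1 : r < 1) :
    Summable fun n : ℕ => r ^ (n + 1) * (n + 1) * ‖A n‖ := by
  obtain ⟨s, hrs, hs1⟩ := exists_between hr1
  have hs0 : 0 < s := hr0.trans hrs
  have hsum := (hA s (by simpa [abs_of_pos hs0] using hs1)).summable
  obtain ⟨B, hB⟩ := (Metric.isBounded_range_of_tendsto _ hsum.tendsto_atTop_zero).exists_norm_le
  have hq : ‖r / s‖ < 1 := by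
    rw [Real.norm_of_nonneg (by positivity), div_lt_one hs0]; exact hrs
  have hgeo : Summable fun n : ℕ => ((n + 1 : ℕ) : ℝ) ^ 1 * (r / s) ^ (n + 1) :=
    (summable_nat_add_iff (f := fun n : ℕ => ((n : ℕ) : ℝ) ^ 1 * (r / s) ^ n) 1).2
      (summable_pow_mul_geometric_of_norm_lt_one 1 hq)
  refine Summable.of_nonneg_of_le (fun n => by positivity) (fun n => ?_) (hgeo.mul_right B)
  have hBn : ‖(s : ℂ) ^ (n + 1) • A n‖ ≤ B := hB _ (Set.mem_range_self n)
  simp only [norm_smul, norm_pow, Complex.norm_real, Real.norm_of_nonneg hs0.le] at hBn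
  calc r ^ (n + 1) * (n + 1) * ‖A n‖
      = ((n + 1 : ℕ) : ℝ) ^ 1 * (r / s) ^ (n + 1) * (s ^ (n + 1) * ‖A n‖) := by
        have := (pow_pos hs0 (n + 1)).ne'
        rw [div_pow, pow_one]
        push_cast
        generalize s ^ (n + 1) = c at *
        field_simp
    _ ≤ ((n + 1 : ℕ) : ℝ) ^ 1 * (r / s) ^ (n + 1) * B :=
        mul_le_mul_of_nonneg_left hBn (by positivity)

theorem norm_chebDensity_term_le (A : ℕ → N →L[ℂ] N) {r : ℝ} (hr0 : 0 < r) (n : ℕ) (θ : ℝ) :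
    ‖((r ^ (n + 1) * chebU n θ : ℝ) : ℂ) • A n‖ ≤ r ^ (n + 1) * (n + 1) * ‖A n‖ := by
  rw [norm_smul, Complex.norm_real, norm_mul, Real.norm_of_nonneg (by positivity)]
  gcongr
  exact abs_chebU_le n θ

variable [CompleteSpace N]

section
variable {A : ℕ → N →L[ℂ] N} {g : ℂ → N →L[ℂ] N}
    (hA : ∀ ζ : ℂ, ‖ζ‖ < 1 → HasSum (fun n => ζ ^ (n + 1) • A n) (g ζ))
    {r : ℝ} (hr0 : 0 < r) (hr1 : r < 1)
include hA hr0 hr1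

theorem hasSum_chebDensity (θ : ℝ) :
    HasSum (fun n : ℕ => ((r ^ (n + 1) * chebU n θ : ℝ) : ℂ) • A n) (chebDensity A r θ) :=
  (Summable.of_norm_bounded (summable_bound_of_hasSum hA hr0 hr1)
    fun n => norm_chebDensity_term_le A hr0 n θ).hasSum

theorem continuous_chebDensity : Continuous (chebDensity A r) := by
  refine continuous_tsum (fun n => ?_) (summable_bound_of_hasSum hA hr0 hr1)
    fun n θ => norm_chebDensity_term_le A hr0 n θ
  have := continuous_chebU n
  fun_prop

/-- Termwise integration reduces every value of the approximating map to scalar moments of φ(cos θ)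
against U_n. -/
theorem hasSum_integralRep (φ : C(Set.Icc (-1 : ℝ) 1, ℂ)) :
    HasSum (fun n : ℕ => ((Real.pi⁻¹ : ℂ) * ((r : ℂ) ^ (n + 1) *
      ∫ θ in (0 : ℝ)..Real.pi, φ (cosIcc θ) * (chebU n θ : ℂ))) • A n)
      (integralRep (chebDensity A r) (continuous_chebDensity hA hr0 hr1) φ) := by
  have hb := summable_bound_of_hasSum hA hr0 hr1
  have h := intervalIntegral.hasSum_integral_of_dominated_convergence (μ := volume) (a := 0)
    (b := Real.pi)
    (F := fun n θ => φ (cosIcc θ) • (((r ^ (n + 1) * chebU n θ : ℝ) : ℂ) • A n))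
    (f := fun θ => φ (cosIcc θ) • chebDensity A r θ)
    (fun n _ => ‖φ‖ * (r ^ (n + 1) * (n + 1) * ‖A n‖))
    (fun n => by
      have h1 := continuous_chebU n
      have h2 := φ.continuous.comp cosIcc.continuous
      have h3 : Continuous fun θ => ((r ^ (n + 1) * chebU n θ : ℝ) : ℂ) • A n := by fun_prop
      exact (h2.smul h3).aestronglyMeasurable)
    (fun n => ae_of_all _ fun θ _ => by
      rw [norm_smul]
      exact mul_le_mul (φ.norm_coe_le_norm _) (norm_chebDensity_term_le A hr0 n θ)
        (norm_nonneg _) (norm_nonneg _))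
    (ae_of_all _ fun θ _ => hb.mul_left _)
    intervalIntegrable_const
    (ae_of_all _ fun θ _ => (hasSum_chebDensity hA hr0 hr1 θ).const_smul _)
  refine (h.const_smul (Real.pi⁻¹ : ℂ)).congr_fun fun n => ?_
  simp_rw [smul_smul]
  rw [intervalIntegral.integral_smul_const, smul_smul]
  congr 2
  rw [← intervalIntegral.integral_const_mul]
  refine intervalIntegral.integral_congr fun θ _ => ?_
  push_cast
  ring

theorem integralRep_one_add_coordFun :
    integralRep (chebDensity A r) (continuous_chebDensity hA hr0 hr1) (1 + coordFun) = g r := by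
  refine (hasSum_integralRep hA hr0 hr1 _).unique
    ((hA r (by simpa [abs_of_pos hr0] using hr1)).congr_fun fun n => ?_)
  have e : ∫ θ in (0 : ℝ)..Real.pi, (1 + coordFun : C(Set.Icc (-1 : ℝ) 1, ℂ)) (cosIcc θ) *
      (chebU n θ : ℂ) = Real.pi := by
    conv_rhs => rw [← integral_one_add_cos_mul_chebU n]
    rw [← intervalIntegral.integral_ofReal]
    refine intervalIntegral.integral_congr fun θ _ => ?_
    simp
  rw [e]
  congr 1
  have : (Real.pi : ℂ) ≠ 0 := by exact_mod_cast Real.pi_ne_zero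
  field_simp

theorem integralRep_one_sub_coordFun :
    integralRep (chebDensity A r) (continuous_chebDensity hA hr0 hr1) (1 - coordFun) =
      -g (-r) := by
  refine (hasSum_integralRep hA hr0 hr1 _).unique
    ((hA (-r) (by simpa [abs_of_pos hr0] using hr1)).neg.congr_fun fun n => ?_)
  have e : ∫ θ in (0 : ℝ)..Real.pi, (1 - coordFun : C(Set.Icc (-1 : ℝ) 1, ℂ)) (cosIcc θ) *
      (chebU n θ : ℂ) = ((Real.pi * (-1) ^ n : ℝ) : ℂ) := by
    rw [← integral_one_sub_cos_mul_chebU n, ← intervalIntegral.integral_ofReal]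
    refine intervalIntegral.integral_congr fun θ _ => ?_
    simp
  rw [e, ← neg_smul]
  congr 1
  have : (Real.pi : ℂ) ≠ 0 := by exact_mod_cast Real.pi_ne_zero
  push_cast
  rw [neg_pow (r : ℂ), pow_succ (-1 : ℂ)]
  field_simp

/-- The functions 2(1 - t²)U_m are biorthogonal to the U_n under dθ/π, so a single Taylor
coefficient survives. -/
theorem integralRep_chebDiff (m : ℕ) :
    integralRep (chebDensity A r) (continuous_chebDensity hA hr0 hr1) (chebDiff m) =
      (r : ℂ) ^ (m + 1) • A m := by
  refine (hasSum_integralRep hA hr0 hr1 _).unique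
    ((hasSum_ite_eq m ((r : ℂ) ^ (m + 1) • A m)).congr_fun fun n => ?_)
  have e : ∫ θ in (0 : ℝ)..Real.pi, chebDiff m (cosIcc θ) * (chebU n θ : ℂ) =
      ((if n = m then Real.pi else 0 : ℝ) : ℂ) := by
    rw [← integral_chebU_mul_chebU m n, ← intervalIntegral.integral_ofReal]
    refine intervalIntegral.integral_congr fun θ _ => ?_
    rw [chebDiff_cosIcc]
    push_cast
    ring
  rw [e]
  have : (Real.pi : ℂ) ≠ 0 := by exact_mod_cast Real.pi_ne_zero
  split_ifs with h
  · subst h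
    congr 1
    field_simp
  · simp

theorem star_chebDensity (hs : ∀ n, star (A n) = A n) (θ : ℝ) :
    star (chebDensity A r θ) = chebDensity A r θ := by
  have h := (hasSum_chebDensity hA hr0 hr1 θ).star
  simp only [star_smul, hs, Complex.star_def, Complex.conj_ofReal] at h
  exact h.unique (hasSum_chebDensity hA hr0 hr1 θ)

/-- Since U_n(cos θ) sin θ = sin((n+1)θ), multiplying by sin θ produces the imaginary part of the
form of g at re^{iθ}, a point of the upper half disk. The endpoints 0 and π, where sin θ vanishes,
follow by continuity. -/
theorem re_inner_chebDensity_nonneg (hs : ∀ n, star (A n) = A n)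
    (hg : ∀ ζ : ℂ, ‖ζ‖ < 1 → 0 < ζ.im → ∀ f, 0 ≤ (inner ℂ f (g ζ f)).im)
    {θ : ℝ} (hθ : θ ∈ Set.Icc 0 Real.pi) (f : N) :
    0 ≤ (inner ℂ f (chebDensity A r θ f)).re := by
  have hmain : ∀ θ ∈ Set.Ioo 0 Real.pi, 0 ≤ (inner ℂ f (chebDensity A r θ f)).re := by
    intro θ hθ
    have hsin := Real.sin_pos_of_mem_Ioo hθ
    let L : (N →L[ℂ] N) →L[ℂ] ℂ := (innerSL ℂ f) ∘L (ContinuousLinearMap.apply ℂ N f)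
    have hL : ∀ B : N →L[ℂ] N, L B = inner ℂ f (B f) := fun B => rfl
    have him : ∀ n, (L (A n)).im = 0 := fun n => by
      have := congrArg Complex.im (inner_adjoint_swap (hs n) f f)
      simp only [Complex.conj_im] at this
      rw [hL]
      linarith
    set ζ : ℂ := r * Complex.exp (θ * I) with hζ
    have hζn : ‖ζ‖ < 1 := by simpa [hζ, abs_of_pos hr0] using hr1
    have hζi : 0 < ζ.im := by
      rw [hζ, Complex.im_ofReal_mul, Complex.exp_ofReal_mul_I_im]
      positivity
    have h1 := Complex.hasSum_im ((hA ζ hζn).mapL L)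
    have h2 := (Complex.hasSum_re ((hasSum_chebDensity hA hr0 hr1 θ).mapL L)).mul_left (Real.sin θ)
    have h3 : Real.sin θ * (L (chebDensity A r θ)).re = (L (g ζ)).im := by
      refine h2.unique (h1.congr_fun fun n => ?_)
      have e : ζ ^ (n + 1) = ((r ^ (n + 1) : ℝ) : ℂ) * Complex.exp ((((n + 1) * θ : ℝ) : ℂ) * I) := by
        rw [hζ, mul_pow, ← Complex.exp_nat_mul]
        push_cast
        ring_nf
      rw [map_smul, map_smul, smul_eq_mul, smul_eq_mul, Complex.re_ofReal_mul, Complex.mul_im, him,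
        mul_zero, zero_add, e, Complex.im_ofReal_mul, Complex.exp_ofReal_mul_I_im, ← chebU_mul_sin]
      ring
    have h4 := hg ζ hζn hζi f
    rw [← hL, ← h3] at h4
    exact nonneg_of_mul_nonneg_right h4 hsin
  have hclosed : IsClosed {θ : ℝ | 0 ≤ (inner ℂ f (chebDensity A r θ f)).re} :=
    isClosed_le continuous_const (Complex.continuous_re.comp (continuous_const.inner
      ((continuous_chebDensity hA hr0 hr1).clm_apply continuous_const)))
  have := closure_minimal hmain hclosed
  rw [closure_Ioo Real.pi_pos.ne] at this
  exact this hθ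

end

end Densities

/-! ### Integral-type representation of W by Blaschke functions -/

section Representation

theorem norm_chebDiff_le (n : ℕ) : ‖chebDiff n‖ ≤ 2 := by
  refine (ContinuousMap.norm_le _ zero_le_two).2 fun t => ?_
  have ht := t.2
  have e : ∀ k : ℤ, (Polynomial.Chebyshev.T ℂ k).eval ((t : ℝ) : ℂ) =
      ((Real.cos (k * Real.arccos t) : ℝ) : ℂ) := fun k => by
    rw [← Polynomial.Chebyshev.complex_ofReal_eval_T, ← Polynomial.Chebyshev.T_real_cos,
      Real.cos_arccos ht.1 ht.2]
  rw [chebDiff, aeval_coordFun_apply, Polynomial.eval_sub, e, e, ← Complex.ofReal_sub,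
    Complex.norm_real, Real.norm_eq_abs]
  refine (abs_sub _ _).trans ?_
  have h1 := Real.abs_cos_le_one ((n : ℤ) * Real.arccos t)
  have h2 := Real.abs_cos_le_one ((n + 2 : ℤ) * Real.arccos t)
  linarith

theorem chebDiff_add_two_apply (n : ℕ) (t : Set.Icc (-1 : ℝ) 1) :
    chebDiff (n + 2) t = 2 * ((t : ℝ) : ℂ) * chebDiff (n + 1) t - chebDiff n t := by
  have h2 := congrArg (Polynomial.eval ((t : ℝ) : ℂ))
    (Polynomial.Chebyshev.U_add_two ℂ (n : ℤ))
  simp only [chebDiff_apply]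
  simp only [Polynomial.eval_sub, Polynomial.eval_mul, Polynomial.eval_X,
    Polynomial.eval_ofNat] at h2
  push_cast
  rw [h2]
  ring

theorem one_sub_mul_ne_zero {z : ℂ} (hz : z ∈ extDomain) (t : Set.Icc (-1 : ℝ) 1) :
    1 - z * ((t : ℝ) : ℂ) ≠ 0 := by
  intro h
  have ht0 : (t : ℝ) ≠ 0 := by
    intro h0
    rw [h0] at h
    simp at h
  have hz' : z = (((t : ℝ)⁻¹ : ℝ) : ℂ) := by
    rw [Complex.ofReal_inv]
    exact eq_inv_of_mul_eq_one_left (by linear_combination -h)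
  refine hz ?_
  rw [hz']
  refine ⟨Complex.ofReal_im _, ?_⟩
  rw [Complex.ofReal_re]
  rcases lt_or_gt_of_ne ht0 with hneg | hpos
  · left
    rw [inv_le_of_neg hneg (by norm_num)]
    linarith [t.2.1]
  · right
    exact (one_le_inv₀ hpos).2 t.2.2

/-- The Blaschke type function `t ↦ (z - t) / (1 - z t)` on `[-1, 1]`. -/
def blaschke (z : ℂ) : C(Set.Icc (-1 : ℝ) 1, ℂ) :=
  (z • 1 - coordFun) * Ring.inverse (1 - z • coordFun)

theorem isUnit_one_sub_smul_coordFun {z : ℂ} (hz : z ∈ extDomain) :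
    IsUnit (1 - z • coordFun) := by
  rw [ContinuousMap.isUnit_iff_forall_ne_zero]
  intro t
  simpa using one_sub_mul_ne_zero hz t

theorem blaschke_apply {z : ℂ} (hz : z ∈ extDomain) (t : Set.Icc (-1 : ℝ) 1) :
    blaschke z t = (z - ((t : ℝ) : ℂ)) / (1 - z * ((t : ℝ) : ℂ)) := by
  have h := DFunLike.congr_fun (Ring.mul_inverse_cancel _ (isUnit_one_sub_smul_coordFun hz)) t
  simp only [ContinuousMap.mul_apply, ContinuousMap.sub_apply, ContinuousMap.one_apply,
    ContinuousMap.smul_apply, coordFun_apply, smul_eq_mul] at h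
  simp only [blaschke, ContinuousMap.mul_apply, ContinuousMap.sub_apply, ContinuousMap.one_apply,
    ContinuousMap.smul_apply, coordFun_apply, smul_eq_mul, mul_one]
  rw [eq_div_iff (one_sub_mul_ne_zero hz t)]
  linear_combination (z - ((t : ℝ) : ℂ)) * h

theorem differentiableAt_blaschke {z : ℂ} (hz : z ∈ extDomain) :
    DifferentiableAt ℂ blaschke z := by
  have h1 : DifferentiableAt ℂ (fun z : ℂ => (1 - z • coordFun : C(Set.Icc (-1 : ℝ) 1, ℂ))) z := by
    fun_prop
  have h2 : DifferentiableAt ℂ (fun z : ℂ => (z • 1 - coordFun : C(Set.Icc (-1 : ℝ) 1, ℂ))) z := by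
    fun_prop
  obtain ⟨u, hu⟩ := isUnit_one_sub_smul_coordFun hz
  have h3 : DifferentiableAt ℂ (Ring.inverse : C(Set.Icc (-1 : ℝ) 1, ℂ) → _) (1 - z • coordFun) := by
    rw [← hu]
    exact differentiableAt_inverse u.isUnit
  have h4 : DifferentiableAt ℂ
      (fun z : ℂ => Ring.inverse (1 - z • coordFun : C(Set.Icc (-1 : ℝ) 1, ℂ))) z :=
    DifferentiableAt.comp (g := fun w : C(Set.Icc (-1 : ℝ) 1, ℂ) => Ring.inverse w) z h3 h1
  exact h2.mul h4

/-- The generating function of the U_n: the three-term recursion gives (1 - 2tζ + ζ²)S = 2ζ(1 - t²),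
and with z = 2ζ/(1 + ζ²) this is S = z(1 - t²)/(1 - zt) = b_z(t) + t. -/
theorem hasSum_chebDiff {ζ : ℂ} (hζ : ‖ζ‖ < 1) :
    HasSum (fun n => ζ ^ (n + 1) • chebDiff n) (blaschke (diskMap ζ) + coordFun) := by
  have hsum : Summable fun n => ζ ^ (n + 1) • chebDiff n := by
    refine Summable.of_norm_bounded (g := fun n => ‖ζ‖ ^ (n + 1) * 2) ?_ fun n => ?_
    · exact (((summable_nat_add_iff (f := fun n => ‖ζ‖ ^ n) 1).2
        (summable_geometric_of_lt_one (norm_nonneg _) hζ))).mul_right 2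
    · rw [norm_smul, norm_pow]
      exact mul_le_mul_of_nonneg_left (norm_chebDiff_le n) (by positivity)
  convert hsum.hasSum using 1
  ext t
  have ha : HasSum (fun n => ζ ^ (n + 1) * chebDiff n t) ((∑' n, ζ ^ (n + 1) • chebDiff n) t) :=
    (hsum.hasSum.mapL (ContinuousMap.evalCLM ℂ t))
  set S := (∑' n, ζ ^ (n + 1) • chebDiff n) t
  have ha1 := (hasSum_nat_add_iff' 1).2 ha
  have ha2 := (hasSum_nat_add_iff' 2).2 ha
  have hrec := ((ha1.mul_left (2 * ((t : ℝ) : ℂ) * ζ)).sub (ha.mul_left (ζ ^ 2))).unique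
    (ha2.congr_fun fun n => by rw [chebDiff_add_two_apply]; ring)
  simp only [Finset.sum_range_succ, Finset.sum_range_zero, zero_add] at hrec
  have h0 : chebDiff 0 t = 2 * (1 - ((t : ℝ) : ℂ) ^ 2) := by simp [chebDiff_apply]
  have h1 : chebDiff 1 t = 2 * (1 - ((t : ℝ) : ℂ) ^ 2) * (2 * ((t : ℝ) : ℂ)) := by
    simp [chebDiff_apply]
  rw [h0, h1] at hrec
  have hz := diskMap_mem_extDomain hζ
  have hne := one_sub_mul_ne_zero hz t
  rw [ContinuousMap.add_apply, blaschke_apply hz, coordFun_apply, div_add' _ _ _ hne,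
    div_eq_iff hne]
  have hq := one_add_sq_ne_zero hζ
  have hm : diskMap ζ * (1 + ζ ^ 2) = 2 * ζ := by rw [diskMap, div_mul_cancel₀ _ hq]
  refine mul_right_cancel₀ hq ?_
  linear_combination (1 - ((t : ℝ) : ℂ) ^ 2 + S * ((t : ℝ) : ℂ)) * hm + hrec

variable {N : Type*} [NormedAddCommGroup N] [InnerProductSpace ℂ N] [CompleteSpace N]

theorem IsPositiveRep.continuous {T : C(Set.Icc (-1 : ℝ) 1, ℂ) →ₗ[ℂ] (N →L[ℂ] N)}
    (hT : IsPositiveRep T) : Continuous T :=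
  AddMonoidHomClass.continuous_of_bound T (‖T 1‖ + 1) fun φ =>
    ContinuousLinearMap.opNorm_le_bound _ (by positivity) fun f =>
      hT.norm_apply_le (by positivity) (by linarith) φ f

/-- On 1 ± t the approximating maps take the values ±W(±x) at real x → 1, so the boundary values
give the limits on 1 and t. On the Chebyshev differences the limits are the Taylor coefficients of
the pulled-back W, and the generating function then identifies T(b_z). -/
theorem IsHerglotzNevanlinna.exists_isPositiveRep {W : ℂ → N →L[ℂ] N}
    (hW : IsHerglotzNevanlinna W) (hd : DifferentiableOn ℂ W extDomain) (h0 : W 0 = 0)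
    {W₁ W₂ : N →L[ℂ] N}
    (hW₁ : ∀ f, Tendsto (fun x : ℝ => W x f) (𝓝[<] 1) (𝓝 (W₁ f)))
    (hW₂ : ∀ f, Tendsto (fun x : ℝ => W (-x) f) (𝓝[<] 1) (𝓝 (W₂ f))) :
    ∃ T : C(Set.Icc (-1 : ℝ) 1, ℂ) →ₗ[ℂ] (N →L[ℂ] N), IsPositiveRep T ∧
      T 1 = (1 / 2 : ℂ) • (W₁ - W₂) ∧ T coordFun = (1 / 2 : ℂ) • (W₁ + W₂) ∧
      ∀ z ∈ extDomain, T (blaschke z) = W z - (1 / 2 : ℂ) • (W₁ + W₂) := by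
  obtain ⟨A, hs, hA⟩ := hW.exists_hasSum hd h0
  -- The shift by 2 makes the first radius 1/2, hence positive.
  set r : ℕ → ℝ := fun k => 1 - 1 / ((k : ℝ) + 2) with hr
  have hr0 : ∀ k, 0 < r k := fun k => by
    simp only [hr, sub_pos]
    rw [div_lt_one (by positivity)]
    have : (0 : ℝ) ≤ k := Nat.cast_nonneg k
    linarith
  have hr1 : ∀ k, r k < 1 := fun k => by
    have : 0 < 1 / ((k : ℝ) + 2) := by positivity
    simp only [hr]
    linarith
  have hrt : Tendsto r atTop (𝓝 1) := by
    have h := (tendsto_one_div_add_atTop_nhds_zero_nat (𝕜 := ℝ)).comp (tendsto_add_atTop_nat 1)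
    have h2 := h.const_sub 1
    rw [sub_zero] at h2
    refine h2.congr fun k => ?_
    simp only [hr, Function.comp]
    push_cast
    ring
  set T : ℕ → C(Set.Icc (-1 : ℝ) 1, ℂ) →ₗ[ℂ] (N →L[ℂ] N) := fun k =>
    integralRep (chebDensity A (r k)) (continuous_chebDensity hA (hr0 k) (hr1 k)) with hTdef
  have hT : ∀ k, IsPositiveRep (T k) := fun k =>
    isPositiveRep_integralRep _ _ (star_chebDensity hA (hr0 k) (hr1 k) hs)
      fun θ hθ f => re_inner_chebDensity_nonneg hA (hr0 k) (hr1 k) hs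
        (fun ζ hζ hi f => hW.2.2 _ (diskMap_im_pos hζ hi) f) hθ f
  set x : ℕ → ℝ := fun k => 2 * r k / (1 + r k ^ 2) with hx
  have hxt : Tendsto x atTop (𝓝[<] 1) := by
    refine tendsto_nhdsWithin_iff.2 ⟨?_, Eventually.of_forall fun k => ?_⟩
    · have h := (hrt.const_mul 2).div ((hrt.pow 2).const_add 1) (by norm_num)
      norm_num at h
      exact h
    · exact (abs_lt.1 (abs_real_diskMap_lt (by rw [abs_of_pos (hr0 k)]; exact hr1 k))).2
  have hp : ∀ f, Tendsto (fun k => T k (1 + coordFun) f) atTop (𝓝 (W₁ f)) := fun f => by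
    refine ((hW₁ f).comp hxt).congr fun k => ?_
    rw [hTdef]
    simp only [Function.comp]
    rw [integralRep_one_add_coordFun hA (hr0 k) (hr1 k), diskMap_ofReal]
  have hm : ∀ f, Tendsto (fun k => T k (1 - coordFun) f) atTop (𝓝 (-W₂ f)) := fun f => by
    refine ((hW₂ f).comp hxt).neg.congr fun k => ?_
    rw [hTdef]
    simp only [Function.comp]
    rw [integralRep_one_sub_coordFun hA (hr0 k) (hr1 k), show -(r k : ℂ) = ((-r k : ℝ) : ℂ) by simp,
      diskMap_ofReal]
    simp [hx, neg_div]
  have hone : ∀ f, Tendsto (fun k => T k 1 f) atTop (𝓝 (((1 / 2 : ℂ) • (W₁ - W₂)) f)) := fun f => by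
    have h := ((hp f).add (hm f)).const_smul (1 / 2 : ℂ)
    refine (h.congr fun k => ?_).trans (le_of_eq ?_)
    · have e : (1 : C(Set.Icc (-1 : ℝ) 1, ℂ)) =
          (1 / 2 : ℂ) • ((1 + coordFun) + (1 - coordFun)) := by
        rw [add_add_sub_cancel, ← two_smul ℂ, smul_smul]; norm_num
      conv_rhs => rw [e]
      simp only [map_smul, map_add, _root_.smul_apply, _root_.add_apply]
    · simp [sub_eq_add_neg]
  have hcoord : ∀ f, Tendsto (fun k => T k coordFun f) atTop
      (𝓝 (((1 / 2 : ℂ) • (W₁ + W₂)) f)) := fun f => by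
    have h := ((hp f).sub (hm f)).const_smul (1 / 2 : ℂ)
    refine (h.congr fun k => ?_).trans (le_of_eq ?_)
    · have e : coordFun = (1 / 2 : ℂ) • ((1 + coordFun) - (1 - coordFun)) := by
        rw [add_sub_sub_cancel, ← two_smul ℂ, smul_smul]; norm_num
      conv_rhs => rw [e]
      simp only [map_smul, map_sub, _root_.smul_apply, _root_.sub_apply]
    · simp
  have hdiff : ∀ n f, Tendsto (fun k => T k (chebDiff n) f) atTop (𝓝 (A n f)) := fun n f => by
    have h : Tendsto (fun k => ((r k : ℂ) ^ (n + 1)) • A n f) atTop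
        (𝓝 (((1 : ℝ) : ℂ) ^ (n + 1) • A n f)) :=
      ((((Complex.continuous_ofReal.tendsto 1).comp hrt).pow (n + 1)).smul_const _)
    rw [Complex.ofReal_one, one_pow, one_smul] at h
    refine h.congr fun k => ?_
    rw [hTdef]
    simp only
    rw [integralRep_chebDiff hA (hr0 k) (hr1 k)]
    rfl
  obtain ⟨S, hS, hlim⟩ := exists_isPositiveRep_tendsto hT (fun f => ⟨_, hone f⟩)
    (fun f => ⟨_, hcoord f⟩) (fun n f => ⟨_, hdiff n f⟩)
  have hS1 : S 1 = (1 / 2 : ℂ) • (W₁ - W₂) := by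
    ext f; exact tendsto_nhds_unique (hlim 1 f) (hone f)
  have hSX : S coordFun = (1 / 2 : ℂ) • (W₁ + W₂) := by
    ext f; exact tendsto_nhds_unique (hlim coordFun f) (hcoord f)
  have hSD : ∀ n, S (chebDiff n) = A n := fun n => by
    ext f; exact tendsto_nhds_unique (hlim _ f) (hdiff n f)
  refine ⟨S, hS, hS1, hSX, fun z hz => ?_⟩
  obtain ⟨ζ, hζ, rfl⟩ := exists_diskMap_eq hz
  have h := (hasSum_chebDiff hζ).map S hS.continuous
  have h2 := h.unique ((hA ζ hζ).congr_fun fun n => by simp [hSD])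
  rw [← h2, map_add, hSX, add_sub_cancel_right]

end Representation

/-! ### Scalar estimates for b_z on and near the unit circle -/

section BoundaryEstimates

theorem neg_mem_extDomain {z : ℂ} (hz : z ∈ extDomain) : -z ∈ extDomain := by
  rintro ⟨h1, h2⟩
  simp only [Complex.neg_im, Complex.neg_re, neg_eq_zero] at h1 h2
  exact hz ⟨h1, h2.symm.imp (by intro; linarith) (by intro; linarith)⟩

theorem mem_extDomain_of_norm_lt_one {z : ℂ} (hz : ‖z‖ < 1) : z ∈ extDomain := by
  rintro ⟨-, h⟩
  have h1 := abs_lt.1 ((Complex.abs_re_le_norm z).trans_lt hz)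
  rcases h with h | h <;> linarith

theorem mem_extDomain_of_norm_eq_one {z : ℂ} (hz : ‖z‖ = 1) (h1 : z ≠ 1) (h2 : z ≠ -1) :
    z ∈ extDomain := by
  rintro ⟨hi, -⟩
  have hn := Complex.sq_norm z
  rw [hz, Complex.normSq_apply, hi] at hn
  have : (z.re - 1) * (z.re + 1) = 0 := by linarith
  rcases mul_eq_zero.1 this with h | h
  · exact h1 (Complex.ext (by simp; linarith) (by simp [hi]))
  · exact h2 (Complex.ext (by simp; linarith) (by simp [hi]))

theorem norm_blaschke_apply_le {z : ℂ} (hz : ‖z‖ < 1) (t : Set.Icc (-1 : ℝ) 1) :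
    ‖blaschke z t‖ ≤ 1 := by
  have hd := mem_extDomain_of_norm_lt_one hz
  rw [blaschke_apply hd, norm_div, div_le_one (norm_pos_iff.2 (one_sub_mul_ne_zero hd t))]
  refine le_of_sq_le_sq ?_ (norm_nonneg _)
  have h1 : z.re * z.re + z.im * z.im < 1 := by
    rw [← Complex.normSq_apply, ← Complex.sq_norm]
    nlinarith [norm_nonneg z]
  have h2 : (t : ℝ) ^ 2 ≤ 1 := by nlinarith [t.2.1, t.2.2]
  rw [Complex.sq_norm, Complex.sq_norm, Complex.normSq_apply, Complex.normSq_apply]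
  simp
  nlinarith [mul_nonneg (sub_nonneg.2 h1.le) (sub_nonneg.2 h2)]

theorem norm_blaschke_apply_eq {z : ℂ} (hz : ‖z‖ = 1) (hd : z ∈ extDomain)
    (t : Set.Icc (-1 : ℝ) 1) : ‖blaschke z t‖ = 1 := by
  rw [blaschke_apply hd, norm_div, div_eq_one_iff_eq (norm_ne_zero_iff.2 (one_sub_mul_ne_zero hd t))]
  refine (sq_eq_sq₀ (norm_nonneg _) (norm_nonneg _)).1 ?_
  have h1 : z.re * z.re + z.im * z.im = 1 := by
    rw [← Complex.normSq_apply, ← Complex.sq_norm, hz, one_pow]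
  rw [Complex.sq_norm, Complex.sq_norm, Complex.normSq_apply, Complex.normSq_apply]
  simp
  linear_combination (1 - (t : ℝ) ^ 2) * h1

theorem star_blaschke_mul_self {z : ℂ} (hz : ‖z‖ = 1) (hd : z ∈ extDomain) :
    star (blaschke z) * blaschke z = 1 := by
  ext t
  simp [Complex.conj_mul', norm_blaschke_apply_eq hz hd]

/-- A point of the upper unit half circle at distance `ε` from `1`. -/
def circlePoint (ε : ℝ) : ℂ := ⟨1 - ε ^ 2 / 2, ε * √(1 - ε ^ 2 / 4)⟩

theorem circlePoint_im_sq {ε : ℝ} (h1 : ε ≤ 1) (h0 : 0 < ε) :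
    (ε * √(1 - ε ^ 2 / 4)) ^ 2 = ε ^ 2 * (1 - ε ^ 2 / 4) := by
  rw [mul_pow, Real.sq_sqrt (by nlinarith)]

theorem norm_circlePoint {ε : ℝ} (h0 : 0 < ε) (h1 : ε ≤ 1) : ‖circlePoint ε‖ = 1 := by
  refine (sq_eq_sq₀ (norm_nonneg _) zero_le_one).1 ?_
  rw [Complex.sq_norm, Complex.normSq_apply, circlePoint]
  linear_combination circlePoint_im_sq h1 h0

theorem circlePoint_im_ne_zero {ε : ℝ} (h0 : 0 < ε) (h1 : ε ≤ 1) : (circlePoint ε).im ≠ 0 := by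
  have : 0 < √(1 - ε ^ 2 / 4) := Real.sqrt_pos.2 (by nlinarith)
  exact (mul_pos h0 this).ne'

/-- For t ≤ 1/2 the left denominator is at least 1/4; for t > 1/2 it is comparable to (1 - t)² + ε².
The constant 32 is convenient, not sharp. -/
theorem mobius_boundary_estimate {ε t : ℝ} (h0 : 0 < ε) (h1 : ε ≤ 1) (ht : -1 ≤ t) (ht' : t ≤ 1) :
    ε ^ 2 * (1 + t) ^ 2 / ((1 - t) ^ 2 + t * ε ^ 2) ≤ 32 * (ε * (1 + t) / (1 - t + t * ε)) := by
  have hε2 : ε ^ 2 ≤ 1 := by nlinarith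
  have hd1 : 0 < (1 - t) ^ 2 + t * ε ^ 2 := by
    rcases le_or_gt t 0 with h | h
    · nlinarith
    · nlinarith [mul_pos h (pow_pos h0 2), sq_nonneg (1 - t)]
  have hd2 : 0 < 1 - t + t * ε := by
    rcases le_or_gt t 0 with h | h
    · nlinarith
    · nlinarith [mul_pos h h0]
  have key : (1 + t) * ε * (1 - t + t * ε) ≤ 32 * ((1 - t) ^ 2 + t * ε ^ 2) := by
    rcases le_or_gt t (1 / 2) with h | h
    · have e1 : 1 / 4 ≤ (1 - t) ^ 2 + t * ε ^ 2 := by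
        rcases le_or_gt t 0 with h' | h'
        · nlinarith
        · nlinarith [mul_pos h' (pow_pos h0 2)]
      have e2 : (1 + t) * ε ≤ 2 := by nlinarith
      have e3 : 1 - t + t * ε ≤ 2 := by nlinarith
      have := mul_le_mul e2 e3 hd2.le zero_le_two
      linarith
    · have e1 : (1 + t) * ε ≤ 2 * ε := by nlinarith
      have e2 : 1 - t + t * ε ≤ (1 - t) + ε := by nlinarith
      have := mul_le_mul e1 e2 hd2.le (by positivity)
      nlinarith [sq_nonneg (1 - t - ε), sq_nonneg (1 - t), mul_pos (sub_pos.2 h) (pow_pos h0 2)]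
  rw [← mul_div_assoc, div_le_div_iff₀ hd1 hd2]
  have := mul_le_mul_of_nonneg_left key (mul_nonneg h0.le (by linarith : 0 ≤ 1 + t))
  nlinarith

/-- This replaces tangential approach to 1, on which the non-tangential limit says nothing, by
radial approach at the same distance ε. -/
theorem normSq_mobius_sub_one_le {ε t : ℝ} (h0 : 0 < ε) (h1 : ε ≤ 1) (ht : -1 ≤ t) (ht' : t ≤ 1)
    (hne : 1 - circlePoint ε * t ≠ 0) :
    Complex.normSq ((circlePoint ε - t) / (1 - circlePoint ε * t) - 1) ≤
      32 * (1 - ((((1 - ε : ℝ) : ℂ) - t) / (1 - ((1 - ε : ℝ) : ℂ) * t)).re) := by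
  have hsq := circlePoint_im_sq h1 h0
  have hd2 : 0 < 1 - t + t * ε := by
    rcases le_or_gt t 0 with h | h
    · nlinarith
    · nlinarith [mul_pos h h0]
  have e1 : Complex.normSq ((circlePoint ε - t) / (1 - circlePoint ε * t) - 1) =
      ε ^ 2 * (1 + t) ^ 2 / ((1 - t) ^ 2 + t * ε ^ 2) := by
    rw [div_sub_one hne, Complex.normSq_div]
    have a1 : Complex.normSq (circlePoint ε - t - (1 - circlePoint ε * t)) =
        ε ^ 2 * (1 + t) ^ 2 := by
      rw [Complex.normSq_apply]
      simp [circlePoint]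
      linear_combination (1 + t) ^ 2 * hsq
    have a2 : Complex.normSq (1 - circlePoint ε * t) = (1 - t) ^ 2 + t * ε ^ 2 := by
      rw [Complex.normSq_apply]
      simp [circlePoint]
      linear_combination t ^ 2 * hsq
    rw [a1, a2]
  have e2 : 1 - ((((1 - ε : ℝ) : ℂ) - t) / (1 - ((1 - ε : ℝ) : ℂ) * t)).re =
      ε * (1 + t) / (1 - t + t * ε) := by
    have : (((1 - ε : ℝ) : ℂ) - t) / (1 - ((1 - ε : ℝ) : ℂ) * t) =
        (((1 - ε - t) / (1 - (1 - ε) * t) : ℝ) : ℂ) := by push_cast; rfl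
    rw [this, Complex.ofReal_re]
    have hd3 : 1 - (1 - ε) * t ≠ 0 := by
      have : 1 - (1 - ε) * t = 1 - t + t * ε := by ring
      rw [this]; exact hd2.ne'
    rw [one_sub_div hd3]
    congr 1 <;> ring
  rw [e1, e2]
  exact mobius_boundary_estimate h0 h1 ht ht'

theorem re_star_blaschke_sub_one_le {ε : ℝ} (h0 : 0 < ε) (h1 : ε ≤ 1) (t : Set.Icc (-1 : ℝ) 1) :
    ((star (blaschke (circlePoint ε) - 1) * (blaschke (circlePoint ε) - 1)) t).re ≤
      (((32 : ℂ) • (1 - blaschke ((1 - ε : ℝ) : ℂ))) t).re := by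
  have hd : circlePoint ε ∈ extDomain := fun h => circlePoint_im_ne_zero h0 h1 h.1
  have hx : ((1 - ε : ℝ) : ℂ) ∈ extDomain := mem_extDomain_of_norm_lt_one (by
    rw [Complex.norm_real, Real.norm_eq_abs, abs_lt]; constructor <;> linarith)
  have h := normSq_mobius_sub_one_le h0 h1 t.2.1 t.2.2 (one_sub_mul_ne_zero hd t)
  rw [← blaschke_apply hd, ← blaschke_apply hx] at h
  have e : (star (blaschke (circlePoint ε) - 1) * (blaschke (circlePoint ε) - 1)) t =
      (Complex.normSq (blaschke (circlePoint ε) t - 1) : ℂ) := by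
    rw [Complex.normSq_eq_conj_mul_self]; simp
  rw [e, Complex.ofReal_re]
  simpa using h

/-- The estimate at 1 transported by b_{-z}(t) = -b_z(-t). -/
theorem re_star_blaschke_neg_add_one_le {ε : ℝ} (h0 : 0 < ε) (h1 : ε ≤ 1)
    (t : Set.Icc (-1 : ℝ) 1) :
    ((star (blaschke (-circlePoint ε) + 1) * (blaschke (-circlePoint ε) + 1)) t).re ≤
      (((32 : ℂ) • (1 + blaschke (-((1 - ε : ℝ) : ℂ)))) t).re := by
  have hd : circlePoint ε ∈ extDomain := fun h => circlePoint_im_ne_zero h0 h1 h.1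
  have hx : ((1 - ε : ℝ) : ℂ) ∈ extDomain := mem_extDomain_of_norm_lt_one (by
    rw [Complex.norm_real, Real.norm_eq_abs, abs_lt]; constructor <;> linarith)
  let s : Set.Icc (-1 : ℝ) 1 := ⟨-t, by linarith [t.2.2], by linarith [t.2.1]⟩
  have h := normSq_mobius_sub_one_le h0 h1 s.2.1 s.2.2 (one_sub_mul_ne_zero hd s)
  have hneg : ∀ z ∈ extDomain, blaschke (-z) t = -blaschke z s := fun z hz => by
    rw [blaschke_apply (neg_mem_extDomain hz), blaschke_apply hz, ← neg_div]
    congr 1 <;> simp [s]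
    ring
  rw [← blaschke_apply hd, ← blaschke_apply hx] at h
  have e : (star (blaschke (-circlePoint ε) + 1) * (blaschke (-circlePoint ε) + 1)) t =
      (Complex.normSq (blaschke (circlePoint ε) s - 1) : ℂ) := by
    rw [Complex.normSq_eq_conj_mul_self]
    simp only [ContinuousMap.mul_apply, ContinuousMap.star_apply, ContinuousMap.add_apply,
      ContinuousMap.one_apply, hneg _ hd, Complex.star_def, map_add, map_sub, map_neg, map_one]
    ring
  rw [e, Complex.ofReal_re]
  simp only [ContinuousMap.smul_apply, ContinuousMap.add_apply, ContinuousMap.one_apply,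
      hneg _ hx, smul_eq_mul]
  simpa [sub_eq_add_neg] using h

end BoundaryEstimates

/-! ### Isometric boundary values force a projection -/

section Necessity

theorem starConvex_extDomain : StarConvex ℝ (0 : ℂ) extDomain := by
  rw [starConvex_zero_iff]
  intro z hz a ha0 ha1 h
  simp only [Complex.real_smul, Complex.im_ofReal_mul, Complex.re_ofReal_mul] at h
  rcases eq_or_lt_of_le ha0 with rfl | ha
  · norm_num at h
  have him : z.im = 0 := (mul_eq_zero.1 h.1).resolve_left ha.ne'
  refine hz ⟨him, h.2.imp (fun h => ?_) (fun h => ?_)⟩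
  · by_contra! hc
    nlinarith
  · by_contra! hc
    nlinarith

theorem isPreconnected_extDomain : IsPreconnected extDomain :=
  (starConvex_extDomain.isPathConnected
    (mem_extDomain_of_norm_lt_one (by simp))).isConnected.isPreconnected

variable {N : Type*} [NormedAddCommGroup N] [InnerProductSpace ℂ N]

theorem re_inner_one_sub (G : N →L[ℂ] N) (f : N) :
    (inner ℂ f ((1 - G) f)).re = ‖f‖ ^ 2 - (inner ℂ f (G f)).re := by
  rw [_root_.sub_apply, inner_sub_right, Complex.sub_re, one_apply_eq_self,
    inner_self_eq_norm_sq_to_K]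
  norm_cast

/-- `D` satisfies the bilinear bound characterizing `D = R^{1/2} X R^{1/2}` with a contraction `X`. -/
def IsBoundedBy (D R : N →L[ℂ] N) : Prop :=
  ∀ f g, 2 * (inner ℂ g (D f)).re ≤ (inner ℂ f (R f)).re + (inner ℂ g (R g)).re

theorem IsBoundedBy.re_inner_le {D G : N →L[ℂ] N} (hD : IsBoundedBy D (1 - G)) (f : N) :
    (inner ℂ f (G f)).re ≤ ‖f‖ ^ 2 := by
  have h := hD 0 f
  rw [re_inner_one_sub, re_inner_one_sub] at h
  simpa using h

variable [CompleteSpace N]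

theorem eq_zero_of_re_inner_eq_zero {A : N →L[ℂ] N} (hA : star A = A)
    (h : ∀ f, (inner ℂ f (A f)).re = 0) : A = 0 := by
  have hz : ∀ f, inner ℂ (A f) f = 0 := fun f => by
    have him := congrArg Complex.im (inner_adjoint_swap hA f f)
    simp only [Complex.conj_im] at him
    rw [← inner_conj_symm, Complex.ext (w := 0) (h f) (by simp; linarith), map_zero]
  have := (inner_map_self_eq_zero (A : N →ₗ[ℂ] N)).1 hz
  ext f
  exact LinearMap.congr_fun this f

theorem re_inner_star_mul_self (A : N →L[ℂ] N) (f : N) :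
    (inner ℂ f ((star A * A) f)).re = ‖A f‖ ^ 2 := by
  rw [mul_apply_eq_comp, ContinuousLinearMap.star_eq_adjoint,
    ContinuousLinearMap.adjoint_inner_right, inner_self_eq_norm_sq_to_K]
  norm_cast

theorem norm_apply_eq_of_star_mul_self {A : N →L[ℂ] N} (hA : star A * A = 1) (f : N) :
    ‖A f‖ = ‖f‖ := by
  have h := re_inner_star_mul_self A f
  have h1 : (inner ℂ f ((1 : N →L[ℂ] N) f)).re = ‖f‖ ^ 2 := by
    rw [one_apply_eq_self, inner_self_eq_norm_sq_to_K]
    norm_cast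
  rw [hA, h1] at h
  exact ((sq_eq_sq₀ (norm_nonneg _) (norm_nonneg _)).1 h).symm

theorem IsBoundedBy.star {D R : N →L[ℂ] N} (h : IsBoundedBy D R) : IsBoundedBy (star D) R := by
  intro f g
  have := h g f
  rw [ContinuousLinearMap.star_eq_adjoint, ContinuousLinearMap.adjoint_inner_right,
    ← inner_conj_symm, Complex.conj_re]
  linarith

variable {T : C(Set.Icc (-1 : ℝ) 1, ℂ) →ₗ[ℂ] (N →L[ℂ] N)} {D : N →L[ℂ] N}

/-- Take g = T(φ)f in the Schwarz inequality and use T(1) ≤ 1, which the bound on D contains. -/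
theorem IsPositiveRep.norm_sq_le (hT : IsPositiveRep T) (hD : IsBoundedBy D (1 - T 1))
    (φ : C(Set.Icc (-1 : ℝ) 1, ℂ)) (f : N) :
    ‖T φ f‖ ^ 2 ≤ (inner ℂ f (T (star φ * φ) f)).re := by
  have h := hT.two_re_le φ f (T φ f)
  have h1 := hD.re_inner_le (T φ f)
  have h2 : (inner ℂ (T φ f) (T φ f)).re = ‖T φ f‖ ^ 2 := by
    rw [inner_self_eq_norm_sq_to_K]; norm_cast
  linarith

theorem IsPositiveRep.norm_sq_apply_le (hT : IsPositiveRep T) (hD : IsBoundedBy D (1 - T 1))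
    (f : N) : ‖D f‖ ^ 2 ≤ (inner ℂ f ((1 - T 1) f)).re := by
  have h := hD f (D f)
  have h1 := hT.inner_map_one_nonneg (D f)
  rw [re_inner_one_sub _ (D f)] at h
  have h2 : (inner ℂ (D f) (D f)).re = ‖D f‖ ^ 2 := by
    rw [inner_self_eq_norm_sq_to_K]; norm_cast
  linarith

/-- The bounds for D and for T(b_z) add up: the terms 1 - T(1) and T(1) cancel to the identity,
leaving 2‖g‖² ≤ ‖f‖² + ‖g‖² for g the image of f. -/
theorem IsPositiveRep.norm_add_blaschke_le (hT : IsPositiveRep T) (hD : IsBoundedBy D (1 - T 1))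
    {z : ℂ} (hz : ‖z‖ < 1) : ‖D + T (blaschke z)‖ ≤ 1 := by
  refine ContinuousLinearMap.opNorm_le_bound _ zero_le_one fun f => ?_
  rw [one_mul]
  set g := (D + T (blaschke z)) f with hg
  have h1 := hD f g
  have h2 := hT.two_re_le (blaschke z) f g
  have h3 := hT.re_inner_mono (φ := star (blaschke z) * blaschke z) (ψ := 1) (fun t => by
    have := norm_blaschke_apply_le hz t
    have e : (star (blaschke z) * blaschke z) t = ((‖blaschke z t‖ ^ 2 : ℝ) : ℂ) := by
      simp [Complex.conj_mul']
    rw [e, Complex.ofReal_re]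
    simpa using this) f
  rw [re_inner_one_sub, re_inner_one_sub] at h1
  have h4 : (inner ℂ g (D f)).re + (inner ℂ g (T (blaschke z) f)).re = ‖g‖ ^ 2 := by
    rw [← Complex.add_re, ← inner_add_right, ← _root_.add_apply, ← hg, inner_self_eq_norm_sq_to_K]
    norm_cast
  refine le_of_sq_le_sq ?_ (norm_nonneg _)
  linarith

/-- Positivity and Schwarz turn a pointwise domination of |Φ|² into ‖T(Φ)f‖² ≤ 32 Re⟨f, T(Ψ)f⟩, so
strong convergence for Ψ yields strong convergence for Φ. -/
theorem IsPositiveRep.tendsto_of_re_le (hT : IsPositiveRep T) (hD : IsBoundedBy D (1 - T 1))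
    {Φ Ψ : ℝ → C(Set.Icc (-1 : ℝ) 1, ℂ)} {f : N}
    (h : ∀ ε, 0 < ε → ε ≤ 1 → ∀ t, ((star (Φ ε) * Φ ε) t).re ≤ (((32 : ℂ) • Ψ ε) t).re)
    (hΨ : Tendsto (fun ε => T (Ψ ε) f) (𝓝[>] 0) (𝓝 0)) :
    Tendsto (fun ε => T (Φ ε) f) (𝓝[>] 0) (𝓝 0) := by
  have h1 : Tendsto (fun ε => 32 * (inner ℂ f (T (Ψ ε) f)).re) (𝓝[>] 0) (𝓝 0) := by
    have := ((Complex.continuous_re.tendsto _).comp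
      (tendsto_const_nhds (x := f).inner (𝕜 := ℂ) hΨ)).const_mul 32
    simpa using this
  have h2 : Tendsto (fun ε => ‖T (Φ ε) f‖ ^ 2) (𝓝[>] 0) (𝓝 0) := by
    refine tendsto_of_tendsto_of_tendsto_of_le_of_le' tendsto_const_nhds h1
      (Eventually.of_forall fun ε => sq_nonneg _) ?_
    filter_upwards [Ioc_mem_nhdsGT (zero_lt_one (α := ℝ))] with ε hε
    refine (hT.norm_sq_le hD _ f).trans ((hT.re_inner_mono (h ε hε.1 hε.2) f).trans (le_of_eq ?_))
    rw [map_smul, _root_.smul_apply, inner_smul_right]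
    simp
  have h3 := h2.sqrt
  rw [Real.sqrt_zero] at h3
  refine tendsto_zero_iff_norm_tendsto_zero.2 (h3.congr fun ε => ?_)
  rw [Real.sqrt_sq (norm_nonneg _)]

theorem tendsto_one_sub_nhdsGT : Tendsto (fun ε : ℝ => 1 - ε) (𝓝[>] 0) (𝓝[<] 1) := by
  refine tendsto_nhdsWithin_iff.2 ⟨?_, ?_⟩
  · have : ContinuousAt (fun ε : ℝ => 1 - ε) 0 := by fun_prop
    simpa using this.tendsto.mono_left nhdsWithin_le_nhds
  · filter_upwards [self_mem_nhdsWithin] with ε hε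
    simpa using hε

/-- If `D + T b_ξ` is isometric on the circle, then `T 1` is a projection and `D` is isometric on
its kernel. -/
theorem IsPositiveRep.isometric_necessary (hT : IsPositiveRep T) (hD : IsBoundedBy D (1 - T 1))
    (h₁ : ∀ f, Tendsto (fun x : ℝ => T (blaschke x) f) (𝓝[<] 1) (𝓝 (T 1 f)))
    (h₂ : ∀ f, Tendsto (fun x : ℝ => T (blaschke (-x)) f) (𝓝[<] 1) (𝓝 (-T 1 f)))
    (hiso : ∀ ξ : ℂ, ‖ξ‖ = 1 → ξ ≠ 1 → ξ ≠ -1 →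
      star (D + T (blaschke ξ)) * (D + T (blaschke ξ)) = 1) :
    T 1 * T 1 = T 1 ∧ star D * D = 1 - T 1 := by
  have hne : ∀ ε : ℝ, 0 < ε → ε ≤ 1 → ∀ x : ℝ, circlePoint ε ≠ x ∧ -circlePoint ε ≠ x :=
    fun ε h0 h1 x => ⟨fun h => circlePoint_im_ne_zero h0 h1 (by rw [h, Complex.ofReal_im]),
      fun h => circlePoint_im_ne_zero h0 h1 (by
        rw [← neg_neg (circlePoint ε), h, Complex.neg_im, Complex.ofReal_im, neg_zero])⟩
  have hplus : ∀ f, ‖D f + T 1 f‖ = ‖f‖ := fun f => by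
    have hlim := hT.tendsto_of_re_le hD (Φ := fun ε => blaschke (circlePoint ε) - 1)
      (Ψ := fun ε => 1 - blaschke ((1 - ε : ℝ) : ℂ)) (f := f)
      (fun ε h0 h1 t => re_star_blaschke_sub_one_le h0 h1 t) (by
        have := ((h₁ f).comp tendsto_one_sub_nhdsGT).const_sub (T 1 f)
        simpa [Function.comp_def] using this)
    have h2 := (hlim.add_const (D f + T 1 f)).norm
    rw [zero_add] at h2
    refine tendsto_nhds_unique h2 (tendsto_const_nhds.congr' ?_)
    filter_upwards [Ioc_mem_nhdsGT (zero_lt_one (α := ℝ))] with ε hε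
    have := norm_apply_eq_of_star_mul_self (hiso _ (norm_circlePoint hε.1 hε.2)
      (by simpa using (hne ε hε.1 hε.2 1).1) (by simpa using (hne ε hε.1 hε.2 (-1)).1)) f
    rw [← this]
    congr 1
    simp only [map_sub, _root_.sub_apply, _root_.add_apply]
    abel
  have hminus : ∀ f, ‖D f - T 1 f‖ = ‖f‖ := fun f => by
    have hlim := hT.tendsto_of_re_le hD (Φ := fun ε => blaschke (-circlePoint ε) + 1)
      (Ψ := fun ε => 1 + blaschke (-((1 - ε : ℝ) : ℂ))) (f := f)
      (fun ε h0 h1 t => re_star_blaschke_neg_add_one_le h0 h1 t) (by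
        have := ((h₂ f).comp tendsto_one_sub_nhdsGT).const_add (T 1 f)
        simpa [Function.comp_def] using this)
    have h2 := (hlim.add_const (D f - T 1 f)).norm
    rw [zero_add] at h2
    refine tendsto_nhds_unique h2 (tendsto_const_nhds.congr' ?_)
    filter_upwards [Ioc_mem_nhdsGT (zero_lt_one (α := ℝ))] with ε hε
    have := norm_apply_eq_of_star_mul_self (hiso (-circlePoint ε)
      (by rw [norm_neg, norm_circlePoint hε.1 hε.2])
      (by simpa using (hne ε hε.1 hε.2 1).2) (by simpa using (hne ε hε.1 hε.2 (-1)).2)) f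
    rw [← this]
    congr 1
    simp only [map_add, _root_.add_apply]
    abel
  -- The upper bounds `hle1` and `hle2` for the two summands add up to exactly ‖f‖², so both must be
  -- equalities.
  have hpar : ∀ f, ‖D f‖ ^ 2 + ‖T 1 f‖ ^ 2 = ‖f‖ ^ 2 := fun f => by
    have := parallelogram_law_with_norm ℂ (D f) (T 1 f)
    rw [hplus, hminus] at this
    nlinarith
  have hle1 : ∀ f, ‖D f‖ ^ 2 ≤ ‖f‖ ^ 2 - (inner ℂ f (T 1 f)).re := fun f => by
    rw [← re_inner_one_sub]; exact hT.norm_sq_apply_le hD f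
  have hle2 : ∀ f, ‖T 1 f‖ ^ 2 ≤ (inner ℂ f (T 1 f)).re := fun f => by
    simpa using hT.norm_sq_le hD 1 f
  have hs := hT.star_map_one
  constructor
  · refine sub_eq_zero.1 (eq_zero_of_re_inner_eq_zero (by simp [hs]) fun f => ?_)
    have h := re_inner_star_mul_self (T 1) f
    rw [hs] at h
    rw [_root_.sub_apply, inner_sub_right, Complex.sub_re, h]
    linarith [hpar f, hle1 f, hle2 f]
  · refine sub_eq_zero.1 (eq_zero_of_re_inner_eq_zero (by simp [hs]) fun f => ?_)
    rw [_root_.sub_apply, inner_sub_right, Complex.sub_re, re_inner_star_mul_self,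
      re_inner_one_sub]
    linarith [hpar f, hle1 f, hle2 f]

end Necessity

/-! ### Multiplicative domains and propagation from one point -/

section Sufficiency

variable {N : Type*} [NormedAddCommGroup N] [InnerProductSpace ℂ N] [CompleteSpace N]
variable {T : C(Set.Icc (-1 : ℝ) 1, ℂ) →ₗ[ℂ] (N →L[ℂ] N)} {D : N →L[ℂ] N}

/-- A linear term cannot be dominated by a quadratic one near 0; test with z a small positive
multiple of the conjugate of w. -/
theorem eq_zero_of_re_smul_le {w : ℂ} {C : ℝ} (h : ∀ z : ℂ, (z * w).re ≤ ‖z‖ ^ 2 * C) : w = 0 := by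
  by_contra hw
  have hw0 : 0 < ‖w‖ ^ 2 := by positivity
  have key : ∀ s : ℝ, 0 < s → 1 ≤ s * C := fun s hs => by
    have h1 := h ((s : ℂ) * (starRingEnd ℂ) w)
    rw [mul_assoc, Complex.conj_mul', Complex.re_ofReal_mul, norm_mul, Complex.norm_real,
      Real.norm_of_nonneg hs.le, RCLike.norm_conj] at h1
    have h2 : (((‖w‖ : ℝ) : ℂ) ^ 2).re = ‖w‖ ^ 2 := by norm_cast
    rw [h2, mul_pow] at h1
    have h3 : (s * ‖w‖ ^ 2) * 1 ≤ (s * ‖w‖ ^ 2) * (s * C) := by nlinarith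
    exact le_of_mul_le_mul_left h3 (by positivity)
  have hC : 0 < C := by linarith [key 1 one_pos]
  have := key (1 / (2 * C)) (by positivity)
  have h2 : 1 / (2 * C) * C = 1 / 2 := by field_simp
  linarith

/-- Choi's multiplicative domain argument for a unimodular function with isometric image. -/
theorem IsPositiveRep.star_map_mul_map (hT : IsPositiveRep T) (hD : IsBoundedBy D (1 - T 1))
    {u : C(Set.Icc (-1 : ℝ) 1, ℂ)} (hu : star u * u = 1) (hTu : star (T u) * T u = T 1)
    (ψ : C(Set.Icc (-1 : ℝ) 1, ℂ)) : star (T u) * T ψ = T (star u * ψ) := by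
  suffices h : ∀ f, inner ℂ f ((star (T u) * T ψ - T (star u * ψ)) f) = 0 by
    have h' : ∀ f, inner ℂ ((star (T u) * T ψ - T (star u * ψ)) f) f = 0 := fun f => by
      rw [← inner_conj_symm, h f, map_zero]
    have := (inner_map_self_eq_zero ((star (T u) * T ψ - T (star u * ψ) : N →L[ℂ] N) :
      N →ₗ[ℂ] N)).1 h'
    refine sub_eq_zero.1 ?_
    ext f
    exact LinearMap.congr_fun this f
  intro f
  have hns : ‖T u f‖ ^ 2 = (inner ℂ f (T 1 f)).re := by
    rw [← re_inner_star_mul_self, hTu]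
  refine eq_zero_of_re_smul_le (C := ((inner ℂ f (T (star ψ * ψ) f)).re - ‖T ψ f‖ ^ 2) / 2)
    fun z => ?_
  -- This Schwarz inequality is an equality at z = 0, so the part of its defect linear in z must
  -- vanish.
  have h := hT.norm_sq_le hD (u + z • ψ) f
  have e1 : star (u + z • ψ) * (u + z • ψ) =
      1 + z • (star u * ψ) + (starRingEnd ℂ z) • star (star u * ψ) +
        ((‖z‖ ^ 2 : ℝ) : ℂ) • (star ψ * ψ) := by
    rw [← hu]
    ext t
    simp only [ContinuousMap.mul_apply, ContinuousMap.add_apply, ContinuousMap.smul_apply,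
      ContinuousMap.star_apply, smul_eq_mul, Complex.star_def, map_add, map_mul,
      Complex.conj_conj, Complex.ofReal_pow, ← Complex.conj_mul']
    ring
  have e2 : (inner ℂ f ((starRingEnd ℂ z) • T (star (star u * ψ)) f)).re =
      (inner ℂ f (z • T (star u * ψ) f)).re := by
    rw [hT.map_star, inner_smul_right, inner_smul_right, ContinuousLinearMap.star_eq_adjoint,
      ContinuousLinearMap.adjoint_inner_right, ← inner_conj_symm, ← map_mul, Complex.conj_re]
  have e3 : ‖T (u + z • ψ) f‖ ^ 2 = ‖T u f‖ ^ 2 +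
      2 * (inner ℂ f (z • (star (T u) * T ψ) f)).re + ‖z‖ ^ 2 * ‖T ψ f‖ ^ 2 := by
    rw [map_add, map_smul, _root_.add_apply, _root_.smul_apply, norm_add_sq (𝕜 := ℂ),
      norm_smul, mul_pow, mul_apply_eq_comp, ContinuousLinearMap.star_eq_adjoint,
      inner_smul_right, inner_smul_right, ContinuousLinearMap.adjoint_inner_right]
    rfl
  rw [e1] at h
  simp only [map_add, map_smul, _root_.add_apply, _root_.smul_apply, inner_add_right,
    Complex.add_re] at h
  simp only [map_add, map_smul, _root_.add_apply, _root_.smul_apply] at e3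
  rw [e2, e3, inner_smul_right f _ ((‖z‖ ^ 2 : ℝ) : ℂ), Complex.re_ofReal_mul, inner_smul_right,
    inner_smul_right] at h
  rw [_root_.sub_apply, inner_sub_right, mul_sub, Complex.sub_re]
  linarith

theorem IsPositiveRep.map_mul_map (hT : IsPositiveRep T) (hD : IsBoundedBy D (1 - T 1))
    {u : C(Set.Icc (-1 : ℝ) 1, ℂ)} (hu : star u * u = 1) (hTu : star (T u) * T u = T 1)
    (ψ : C(Set.Icc (-1 : ℝ) 1, ℂ)) : T (ψ * u) = T ψ * T u := by
  have h := congrArg star (hT.star_map_mul_map hD hu hTu (star ψ))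
  rw [star_mul, star_star, ← hT.map_star, ← hT.map_star, star_star, star_mul, star_star,
    star_star] at h
  exact h.symm

/-- The functions `φ` with `T (ψ φ) = T ψ T φ` for all `ψ`. -/
def multiplicativeDomain (T : C(Set.Icc (-1 : ℝ) 1, ℂ) →ₗ[ℂ] (N →L[ℂ] N))
    (h : ∀ ψ, T (ψ * 1) = T ψ * T 1) : Subalgebra ℂ C(Set.Icc (-1 : ℝ) 1, ℂ) where
  carrier := {φ | ∀ ψ, T (ψ * φ) = T ψ * T φ}
  mul_mem' {φ φ'} hφ hφ' ψ := by
    rw [← mul_assoc, hφ', hφ, hφ' φ, mul_assoc]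
  add_mem' {φ φ'} hφ hφ' ψ := by
    rw [mul_add, map_add, hφ, hφ', map_add, mul_add]
  algebraMap_mem' c ψ := by
    rw [Algebra.algebraMap_eq_smul_one, mul_smul_comm, map_smul, h, map_smul, mul_smul_comm]

theorem isClosed_multiplicativeDomain (hT : IsPositiveRep T)
    (h : ∀ ψ, T (ψ * 1) = T ψ * T 1) :
    IsClosed (multiplicativeDomain T h : Set C(Set.Icc (-1 : ℝ) 1, ℂ)) := by
  have e : (multiplicativeDomain T h : Set C(Set.Icc (-1 : ℝ) 1, ℂ)) =
      ⋂ ψ, {φ | T (ψ * φ) = T ψ * T φ} := by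
    ext φ
    simp only [Set.mem_iInter]
    rfl
  rw [e]
  have hc := hT.continuous
  exact isClosed_iInter fun ψ => isClosed_eq (by fun_prop) (by fun_prop)

/-- Here b_η = (c + b_ξ)/(1 + c b_ξ) with c = (η - ξ)/(1 - ηξ); for |c| < 1 the inverse is a
geometric series, which stays in a closed subalgebra. -/
theorem blaschke_mem_of_norm_lt {S : Subalgebra ℂ C(Set.Icc (-1 : ℝ) 1, ℂ)}
    (hS : IsClosed (S : Set C(Set.Icc (-1 : ℝ) 1, ℂ))) {ξ η : ℂ} (hξ : ‖ξ‖ = 1)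
    (hξd : ξ ∈ extDomain) (hηd : η ∈ extDomain) (hmem : blaschke ξ ∈ S)
    (hne : 1 - η * ξ ≠ 0) (hlt : ‖(η - ξ) / (1 - η * ξ)‖ < 1) : blaschke η ∈ S := by
  set c := (η - ξ) / (1 - η * ξ) with hc
  set q : C(Set.Icc (-1 : ℝ) 1, ℂ) := -(c • blaschke ξ) with hq
  have hqn : ‖q‖ < 1 := by
    have hu : ‖blaschke ξ‖ ≤ 1 :=
      (ContinuousMap.norm_le _ zero_le_one).2 fun t => (norm_blaschke_apply_eq hξ hξd t).le
    rw [hq, norm_neg, norm_smul]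
    nlinarith [norm_nonneg c, norm_nonneg (blaschke ξ)]
  have hqS : q ∈ S := S.neg_mem (S.smul_mem hmem c)
  have hv : ∑' n : ℕ, q ^ n ∈ S :=
    hS.mem_of_tendsto (summable_geometric_of_norm_lt_one hqn).hasSum
      (Eventually.of_forall fun s => S.sum_mem fun n _ => S.pow_mem hqS n)
  have hinv := mul_neg_geom_series q hqn
  have e : blaschke η * (1 - q) = c • 1 + blaschke ξ := by
    ext t
    have h1 := one_sub_mul_ne_zero hξd t
    have h2 := one_sub_mul_ne_zero hηd t
    simp only [hq, ContinuousMap.mul_apply, ContinuousMap.sub_apply, ContinuousMap.neg_apply,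
      ContinuousMap.add_apply, ContinuousMap.smul_apply, ContinuousMap.one_apply, smul_eq_mul,
      blaschke_apply hξd, blaschke_apply hηd, hc]
    generalize ((t : ℝ) : ℂ) = s at h1 h2
    have h1' : 1 - s * ξ ≠ 0 := by rwa [mul_comm]
    have h2' : 1 - s * η ≠ 0 := by rwa [mul_comm]
    field_simp
    ring
  have e2 : blaschke η = (c • 1 + blaschke ξ) * ∑' n : ℕ, q ^ n := by
    rw [← e, mul_assoc, hinv, mul_one]
  rw [e2]
  exact S.mul_mem (S.add_mem (S.smul_mem S.one_mem c) hmem) hv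

/-- Near ξ the parameter c is small, so membership holds on a neighbourhood. The defect T(ψ b_η) -
T(ψ)T(b_η) is holomorphic in η on the connected slit plane, hence zero everywhere. -/
theorem IsPositiveRep.blaschke_mem_multiplicativeDomain (hT : IsPositiveRep T)
    (h : ∀ ψ, T (ψ * 1) = T ψ * T 1) {ξ η : ℂ} (hξ : ‖ξ‖ = 1) (hξd : ξ ∈ extDomain)
    (hηd : η ∈ extDomain) (hmem : blaschke ξ ∈ multiplicativeDomain T h) :
    blaschke η ∈ multiplicativeDomain T h := by
  intro ψ
  have hne : 1 - ξ * ξ ≠ 0 := by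
    intro h0
    have : (ξ - 1) * (ξ + 1) = 0 := by linear_combination -h0
    rcases mul_eq_zero.1 this with h1 | h1
    · exact hξd (by rw [sub_eq_zero.1 h1]; simp)
    · exact hξd (by rw [eq_neg_of_add_eq_zero_left h1]; simp)
  let Tc : C(Set.Icc (-1 : ℝ) 1, ℂ) →L[ℂ] (N →L[ℂ] N) := ⟨T, hT.continuous⟩
  have hdiff : DifferentiableOn ℂ (fun η => Tc (ψ * blaschke η) - T ψ * Tc (blaschke η))
      extDomain := fun η hη => by
    have hb := differentiableAt_blaschke hη
    have h1 : DifferentiableAt ℂ (fun η => Tc (ψ * blaschke η)) η :=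
      Tc.differentiableAt.comp η (hb.const_mul ψ)
    have h2 : DifferentiableAt ℂ (fun η => Tc (blaschke η)) η := Tc.differentiableAt.comp η hb
    exact (h1.sub (h2.const_mul (T ψ))).differentiableWithinAt
  have hloc : (fun η => Tc (ψ * blaschke η) - T ψ * Tc (blaschke η)) =ᶠ[𝓝 ξ] 0 := by
    have hcont : ContinuousAt (fun η : ℂ => (η - ξ) / (1 - η * ξ)) ξ := by
      fun_prop (disch := exact hne)
    have e1 : ∀ᶠ η in 𝓝 ξ, ‖(η - ξ) / (1 - η * ξ)‖ < 1 := by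
      refine hcont.norm.eventually_lt continuousAt_const ?_
      simp
    have e2 : ∀ᶠ η in 𝓝 ξ, 1 - η * ξ ≠ 0 :=
      ContinuousAt.eventually_ne (g := fun η : ℂ => 1 - η * ξ) (by fun_prop) hne
    filter_upwards [e1, e2, isOpen_extDomain.mem_nhds hξd] with η h1 h2 h3
    exact sub_eq_zero.2
      (blaschke_mem_of_norm_lt (isClosed_multiplicativeDomain hT h) hξ hξd h3 hmem h2 h1 ψ)
  have := (hdiff.analyticOnNhd isOpen_extDomain).eqOn_zero_of_preconnected_of_eventuallyEq_zero
    isPreconnected_extDomain hξd hloc hηd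
  exact sub_eq_zero.1 this

/-- If `T 1` is a projection, `D` is isometric on its kernel, and `D + T b_ξ` is isometric for one
`ξ`, then it is isometric for all of them. -/
theorem IsPositiveRep.isometric_of_point (hT : IsPositiveRep T) (hD : IsBoundedBy D (1 - T 1))
    (hproj : T 1 * T 1 = T 1) (hDD : star D * D = 1 - T 1) {ξ η : ℂ} (hξ : ‖ξ‖ = 1)
    (hξd : ξ ∈ extDomain) (hη : ‖η‖ = 1) (hηd : η ∈ extDomain)
    (hiso : star (D + T (blaschke ξ)) * (D + T (blaschke ξ)) = 1) :
    star (D + T (blaschke η)) * (D + T (blaschke η)) = 1 := by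
  have hs := hT.star_map_one
  -- The case u = 1 of Choi's argument: a projection T(1) acts as a unit for the range of T.
  have hone : ∀ ψ, T (ψ * 1) = T ψ * T 1 :=
    hT.map_mul_map hD (by simp) (by rw [hs, hproj])
  have hone' : ∀ ψ, T 1 * T ψ = T ψ := fun ψ => by
    have := congrArg star (hone (star ψ))
    rwa [mul_one, star_mul, hs, ← hT.map_star, star_star, eq_comm] at this
  -- The bound on D passes to D* and gives ‖D*Gf‖² ≤ ⟨Gf, (1 - G)Gf⟩ = 0.
  have hDG : star D * T 1 = 0 := by
    ext f
    have h := hT.norm_sq_apply_le hD.star (T 1 f)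
    have e : (1 - T 1) (T 1 f) = 0 := by
      rw [← mul_apply_eq_comp, sub_mul, hproj, one_mul, sub_self, _root_.zero_apply]
    rw [e, inner_zero_right, Complex.zero_re] at h
    rw [mul_apply_eq_comp, _root_.zero_apply]
    exact norm_eq_zero.1 (by nlinarith [norm_nonneg (star D (T 1 f))])
  have hcross : ∀ ψ, star D * T ψ = 0 := fun ψ => by
    rw [← hone' ψ, ← mul_assoc, hDG, zero_mul]
  have hcross' : ∀ ψ, star (T ψ) * D = 0 := fun ψ => by
    have := congrArg star (hcross ψ)
    rwa [star_mul, star_star, star_zero] at this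
  have hexp : ∀ ψ, star (D + T ψ) * (D + T ψ) = 1 - T 1 + star (T ψ) * T ψ := fun ψ => by
    rw [star_add, add_mul, mul_add, mul_add, hcross, hcross', hDD, add_zero, zero_add]
  have hξiso : star (T (blaschke ξ)) * T (blaschke ξ) = T 1 := by
    have h1 := hexp (blaschke ξ)
    rw [hiso] at h1
    have : star (T (blaschke ξ)) * T (blaschke ξ) =
        (1 - T 1 + star (T (blaschke ξ)) * T (blaschke ξ)) - 1 + T 1 := by abel
    rw [this, ← h1, sub_self, zero_add]
  have hmem : blaschke ξ ∈ multiplicativeDomain T hone :=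
    hT.map_mul_map hD (star_blaschke_mul_self hξ hξd) hξiso
  have hmem' := hT.blaschke_mem_multiplicativeDomain hone hξ hξd hηd hmem
  rw [hexp, ← hT.map_star, ← hmem' (star (blaschke η)), star_blaschke_mul_self hη hηd,
    sub_add_cancel]

theorem conj_mem_extDomain {z : ℂ} (hz : z ∈ extDomain) : (starRingEnd ℂ) z ∈ extDomain := by
  simpa [extDomain] using hz

theorem star_blaschke {z : ℂ} (hz : z ∈ extDomain) :
    star (blaschke z) = blaschke ((starRingEnd ℂ) z) := by
  ext t
  rw [ContinuousMap.star_apply, blaschke_apply hz, blaschke_apply (conj_mem_extDomain hz)]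
  simp

end Sufficiency

/-! ### Boundary values and the canonical form of the class -/

section CanonicalForm

variable {N : Type*} [NormedAddCommGroup N] [InnerProductSpace ℂ N]

/-- On a radius |z - ξ| = 1 - |z|, so any aperture above 1 would serve. -/
theorem tendsto_mul_stolzRegion {ξ : ℂ} (hξ : ‖ξ‖ = 1) :
    Tendsto (fun x : ℝ => (x : ℂ) * ξ) (𝓝[<] 1) (𝓝[stolzRegion ξ 2] ξ) := by
  refine tendsto_nhdsWithin_iff.2 ⟨?_, ?_⟩
  · have : ContinuousAt (fun x : ℝ => (x : ℂ) * ξ) 1 := by fun_prop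
    simpa using this.tendsto.mono_left nhdsWithin_le_nhds
  · filter_upwards [Ioo_mem_nhdsLT (zero_lt_one (α := ℝ))] with x hx
    have h1 : ‖(x : ℂ) * ξ‖ = x := by
      rw [norm_mul, hξ, mul_one, Complex.norm_real, Real.norm_of_nonneg hx.1.le]
    have h2 : ‖(x : ℂ) * ξ - ξ‖ = 1 - x := by
      rw [show (x : ℂ) * ξ - ξ = ((x - 1 : ℝ) : ℂ) * ξ by push_cast; ring, norm_mul, hξ, mul_one,
        Complex.norm_real, Real.norm_of_nonpos (by linarith [hx.2]), neg_sub]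
    refine ⟨by rw [h1]; exact hx.2, ?_⟩
    rw [h1, h2]
    linarith [hx.2]

theorem IsBoundaryValue.unique {Θ : ℂ → N →L[ℂ] N} {ξ : ℂ} (hξ : ‖ξ‖ = 1) {L L' : N →L[ℂ] N}
    (h : IsBoundaryValue Θ ξ L) (h' : IsBoundaryValue Θ ξ L') : L = L' := by
  ext f
  exact tendsto_nhds_unique ((h f 2).comp (tendsto_mul_stolzRegion hξ))
    ((h' f 2).comp (tendsto_mul_stolzRegion hξ))

theorem isBoundaryValue_of_continuousAt {Θ V : ℂ → N →L[ℂ] N} {ξ : ℂ}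
    (hV : ContinuousAt V ξ) (h : ∀ z, ‖z‖ < 1 → Θ z = V z) : IsBoundaryValue Θ ξ (V ξ) := by
  intro f M
  have h1 : Tendsto (fun z => V z f) (𝓝[stolzRegion ξ M] ξ) (𝓝 (V ξ f)) :=
    (hV.clm_apply continuousAt_const).tendsto.mono_left nhdsWithin_le_nhds
  refine h1.congr' ?_
  filter_upwards [self_mem_nhdsWithin] with z hz
  rw [h z hz.1]

theorem norm_exp_mul_I (t : ℝ) : ‖Complex.exp (t * I)‖ = 1 := Complex.norm_exp_ofReal_mul_I t

/-- An identity for continuous boundary values that holds almost everywhere on the circle holds at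
every point other than `±1`. -/
theorem forall_circle_of_ae {Θ : ℂ → N →L[ℂ] N} {V : ℂ → N →L[ℂ] N}
    (hV : ∀ z ∈ extDomain, ContinuousAt V z) (hΘ : ∀ z, ‖z‖ < 1 → Θ z = V z)
    {q : (N →L[ℂ] N) → N →L[ℂ] N} (hq : Continuous q)
    (h : ∀ᵐ t : ℝ, ∃ L : N →L[ℂ] N, IsBoundaryValue Θ (Complex.exp (t * I)) L ∧ q L = 1)
    {ξ : ℂ} (hξ : ‖ξ‖ = 1) (hξd : ξ ∈ extDomain) : q (V ξ) = 1 := by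
  obtain ⟨t₀, rfl⟩ : ∃ t : ℝ, Complex.exp (t * I) = ξ := by
    refine ⟨ξ.arg, ?_⟩
    have := Complex.norm_mul_exp_arg_mul_I ξ
    rwa [hξ, Complex.ofReal_one, one_mul] at this
  by_contra hne
  have hexp : ContinuousAt (fun t : ℝ => Complex.exp (t * I)) t₀ := by fun_prop
  have hcont : ContinuousAt (fun t : ℝ => q (V (Complex.exp (t * I)))) t₀ :=
    hq.continuousAt.comp (ContinuousAt.comp (g := V) (hV _ hξd) hexp)
  have h1 := hcont.eventually_ne hne
  -- A set of full measure is dense, so good parameters occur arbitrarily near t₀, against the open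
  -- condition that the identity fails.
  have h2 : ∃ᶠ t : ℝ in 𝓝 t₀, ∃ L : N →L[ℂ] N, IsBoundaryValue Θ (Complex.exp (t * I)) L ∧ q L = 1 :=
    mem_closure_iff_frequently.1 (Measure.dense_of_ae h t₀)
  have h3 := hexp.eventually (isOpen_extDomain.mem_nhds hξd)
  obtain ⟨t, ⟨L, hL, hqL⟩, ht1, ht2⟩ := (h2.and_eventually (h1.and h3)).exists
  rw [hL.unique (norm_exp_mul_I t) (isBoundaryValue_of_continuousAt (hV _ ht2) hΘ)] at hqL
  exact ht1 hqL

theorem half_smul_le_one {A : N →L[ℂ] N} (h : A ≤ (2 : ℂ) • 1) : (1 / 2 : ℂ) • A ≤ 1 := by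
  rw [ContinuousLinearMap.le_def] at h ⊢
  have h2 := h.smul_of_nonneg (c := (1 / 2 : ℂ)) (by norm_num [Complex.le_def])
  rw [smul_sub, smul_smul] at h2
  norm_num at h2 ⊢
  exact h2

variable [CompleteSpace N]

/-- With Q = R^{1/2} the form is at most ‖Qg‖‖Qf‖, and the arithmetic-geometric mean inequality
splits the product. Only this consequence of (S3) is used. -/
theorem isBoundedBy_of_mem_operatorBall {S R B : N →L[ℂ] N} (hR : 0 ≤ R)
    (hB : B ∈ operatorBall S R) : IsBoundedBy (B - S) R := by
  obtain ⟨X, hX, rfl⟩ := hB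
  intro f g
  set Q := CFC.sqrt R with hQ
  have hQs : star Q = Q := (CFC.sqrt_nonneg R).isSelfAdjoint
  have hQQ : Q * Q = R := CFC.sqrt_mul_sqrt_self R hR
  have hn : ∀ f, (inner ℂ f (R f)).re = ‖Q f‖ ^ 2 := fun f => by
    rw [← re_inner_star_mul_self, hQs, hQQ]
  rw [add_sub_cancel_left, hn, hn]
  simp only [ContinuousLinearMap.comp_apply]
  set w := R.range.topologicalClosure.orthogonalProjectionOnto (Q f) with hw
  set v : N := R.range.topologicalClosure.subtypeL (X w) with hv
  have hvn : ‖v‖ ≤ ‖Q f‖ := by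
    calc ‖v‖ = ‖X w‖ := rfl
      _ ≤ ‖w‖ := hX _
      _ ≤ ‖Q f‖ := Submodule.norm_orthogonalProjectionOnto_apply_le _ _
  have h1 : inner ℂ g (Q v) = inner ℂ (Q g) v := by
    conv_lhs => rw [← hQs]
    rw [ContinuousLinearMap.star_eq_adjoint, ContinuousLinearMap.adjoint_inner_right]
  have h2 : (inner ℂ (Q g) v).re ≤ ‖Q g‖ * ‖v‖ :=
    (Complex.re_le_norm _).trans (norm_inner_le_norm _ _)
  rw [h1]
  nlinarith [mul_le_mul_of_nonneg_left hvn (norm_nonneg (Q g)), sq_nonneg (‖Q f‖ - ‖Q g‖)]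

/-- The canonical form `Θ(z) = D + T((z - t) / (1 - z t))` of functions of the class `S^qs`. -/
theorem ClassSqs.exists_isPositiveRep {Θ : ℂ → N →L[ℂ] N} (hΘ : ClassSqs Θ) :
    ∃ (T : C(Set.Icc (-1 : ℝ) 1, ℂ) →ₗ[ℂ] (N →L[ℂ] N)) (D : N →L[ℂ] N),
      IsPositiveRep T ∧ IsBoundedBy D (1 - T 1) ∧
      IsBoundaryValue Θ 1 (D + T 1) ∧ IsBoundaryValue Θ (-1) (D - T 1) ∧
      (∀ f, Tendsto (fun x : ℝ => T (blaschke x) f) (𝓝[<] 1) (𝓝 (T 1 f))) ∧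
      (∀ f, Tendsto (fun x : ℝ => T (blaschke (-x)) f) (𝓝[<] 1) (𝓝 (-T 1 f))) ∧
      ∀ z, ‖z‖ < 1 → Θ z = D + T (blaschke z) := by
  obtain ⟨⟨W, hW, hd, hWΘ⟩, W₁, W₂, hb₁, hb₂, hle, hball⟩ := hΘ
  have hWΘ' : ∀ z : ℂ, ‖z‖ < 1 → W z = Θ z - Θ 0 := fun z hz => hWΘ z (mem_ball_zero_iff.2 hz)
  have hW0 : W 0 = 0 := by rw [hWΘ' 0 (by simp), sub_self]
  have hW₁ : ∀ f, Tendsto (fun x : ℝ => W x f) (𝓝[<] 1) (𝓝 (W₁ f)) := fun f => by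
    refine ((hb₁ f 2).comp (tendsto_mul_stolzRegion (by simp))).congr' ?_
    filter_upwards [Ioo_mem_nhdsLT (zero_lt_one (α := ℝ))] with x hx
    rw [hWΘ' x (by rw [Complex.norm_real, Real.norm_of_nonneg hx.1.le]; exact hx.2)]
    simp
  have hW₂ : ∀ f, Tendsto (fun x : ℝ => W (-x) f) (𝓝[<] 1) (𝓝 (W₂ f)) := fun f => by
    refine ((hb₂ f 2).comp (tendsto_mul_stolzRegion (by simp))).congr' ?_
    filter_upwards [Ioo_mem_nhdsLT (zero_lt_one (α := ℝ))] with x hx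
    rw [hWΘ' (-x) (by rw [norm_neg, Complex.norm_real, Real.norm_of_nonneg hx.1.le]; exact hx.2)]
    simp
  obtain ⟨T, hT, hT1, hTX, hTW⟩ := hW.exists_isPositiveRep hd hW0 hW₁ hW₂
  have hsum : T 1 + T coordFun = W₁ := by
    rw [hT1, hTX, ← smul_add, sub_add_add_cancel, ← two_smul ℂ, smul_smul]; norm_num
  have hdiff : T coordFun - T 1 = W₂ := by
    rw [hT1, hTX, ← smul_sub, add_sub_sub_cancel, add_comm, ← two_smul ℂ, smul_smul]; norm_num
  have hx : ∀ x : ℝ, x ∈ Set.Ioo (0 : ℝ) 1 → ‖(x : ℂ)‖ < 1 := fun x hx => by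
    rw [Complex.norm_real, Real.norm_of_nonneg hx.1.le]; exact hx.2
  have hadd : ∀ {ξ : ℂ} {L : N →L[ℂ] N}, IsBoundaryValue (fun z => Θ z - Θ 0) ξ L →
      IsBoundaryValue Θ ξ (Θ 0 + L) := fun {ξ L} h f M => by
    have := (h f M).const_add (Θ 0 f)
    simpa using this
  have hTW' : ∀ z ∈ extDomain, T (blaschke z) = W z - T coordFun := fun z hz => by
    rw [hTW z hz, hTX]
  -- Since T(t) = (W(1) + W(-1))/2 = -S, this D is Θ(0) - S, the deviation from the centre of the
  -- operator ball.
  refine ⟨T, Θ 0 + T coordFun, hT, ?_, ?_, ?_, fun f => ?_, fun f => ?_, fun z hz => ?_⟩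
  · rw [← hT1, ← hTX] at hball
    have h := isBoundedBy_of_mem_operatorBall (sub_nonneg.2 ?_) hball
    · rwa [sub_neg_eq_add] at h
    · rw [hT1]
      exact half_smul_le_one hle
  · convert hadd hb₁ using 1
    rw [← hsum]; abel
  · convert hadd hb₂ using 1
    rw [← hdiff]; abel
  · have h := (hW₁ f).sub_const (T coordFun f)
    rw [← hsum, _root_.add_apply, add_sub_cancel_right] at h
    refine h.congr' ?_
    filter_upwards [Ioo_mem_nhdsLT (zero_lt_one (α := ℝ))] with x hx'
    rw [hTW' _ (mem_extDomain_of_norm_lt_one (hx x hx'))]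
    rfl
  · have h := (hW₂ f).sub_const (T coordFun f)
    rw [← hdiff, _root_.sub_apply, sub_sub_cancel_left] at h
    refine h.congr' ?_
    filter_upwards [Ioo_mem_nhdsLT (zero_lt_one (α := ℝ))] with x hx'
    rw [hTW' _ (neg_mem_extDomain (mem_extDomain_of_norm_lt_one (hx x hx')))]
    rfl
  · rw [hTW' _ (mem_extDomain_of_norm_lt_one hz), hWΘ' z hz]
    abel

theorem ae_exp_mul_I_ne : ∀ᵐ t : ℝ, Complex.exp (t * I) ≠ 1 ∧ Complex.exp (t * I) ≠ -1 := by
  have hc : (Set.range fun n : ℤ => (n : ℝ) * Real.pi).Countable := Set.countable_range _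
  filter_upwards [hc.ae_notMem volume] with t ht
  have key : Complex.exp (t * I) ^ 2 ≠ 1 := fun h => by
    rw [← Complex.exp_nat_mul, Complex.exp_eq_one_iff] at h
    obtain ⟨n, hn⟩ := h
    refine ht ⟨n, ?_⟩
    have := congrArg Complex.im hn
    simp at this
    simp only
    linarith
  exact ⟨fun h => key (by rw [h]; norm_num), fun h => key (by rw [h]; norm_num)⟩

/-- Taking adjoints preserves the canonical form, with D* in place of D and z̄ in place of z; this
reduces the co-inner statements to the inner ones. -/
theorem IsPositiveRep.star_add_map_blaschke {T : C(Set.Icc (-1 : ℝ) 1, ℂ) →ₗ[ℂ] (N →L[ℂ] N)}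
    (hT : IsPositiveRep T) (D : N →L[ℂ] N) {z : ℂ} (hz : z ∈ extDomain) :
    star (D + T (blaschke z)) = star D + T (blaschke ((starRingEnd ℂ) z)) := by
  rw [star_add, ← hT.map_star, star_blaschke hz]

end CanonicalForm

end QuasiSelfadjoint

end

/-! ### The theorem -/

open QuasiSelfadjoint

theorem theorem4p3 {N : Type*} [NormedAddCommGroup N] [InnerProductSpace ℂ N] [CompleteSpace N]
    (Θ : ℂ → N →L[ℂ] N) (hΘ : QuasiSelfadjoint.ClassSqs Θ) :
    ∃ P Q : N →L[ℂ] N,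
      -- `P = Θ(1)` and `Q = Θ(-1)`
      QuasiSelfadjoint.IsBoundaryValue Θ 1 P ∧ QuasiSelfadjoint.IsBoundaryValue Θ (-1) Q ∧
      (QuasiSelfadjoint.IsInnerFunction Θ →
        IsStarProjection ((1 / 2 : ℂ) • (P - Q)) ∧
        star (P + Q) * (P + Q) = (4 : ℂ) • (1 : N →L[ℂ] N) - (2 : ℂ) • (P - Q)) ∧
      (QuasiSelfadjoint.IsCoInnerFunction Θ →
        IsStarProjection ((1 / 2 : ℂ) • (P - Q)) ∧
        (P + Q) * star (P + Q) = (4 : ℂ) • (1 : N →L[ℂ] N) - (2 : ℂ) • (P - Q)) ∧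
      (((1 / 2 : ℂ) • (P - Q)) ^ 2 = (1 / 2 : ℂ) • (P - Q) →
        star (P + Q) * (P + Q) = (4 : ℂ) • (1 : N →L[ℂ] N) - (2 : ℂ) • (P - Q) →
        (∃ (ξ : ℂ) (L : N →L[ℂ] N), ‖ξ‖ = 1 ∧ ξ ≠ 1 ∧ ξ ≠ -1 ∧
          QuasiSelfadjoint.IsBoundaryValue Θ ξ L ∧ star L * L = 1) →
        QuasiSelfadjoint.IsInnerFunction Θ) ∧
      (((1 / 2 : ℂ) • (P - Q)) ^ 2 = (1 / 2 : ℂ) • (P - Q) →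
        (P + Q) * star (P + Q) = (4 : ℂ) • (1 : N →L[ℂ] N) - (2 : ℂ) • (P - Q) →
        (∃ (ξ : ℂ) (L : N →L[ℂ] N), ‖ξ‖ = 1 ∧ ξ ≠ 1 ∧ ξ ≠ -1 ∧
          QuasiSelfadjoint.IsBoundaryValue Θ ξ L ∧ L * star L = 1) →
        QuasiSelfadjoint.IsCoInnerFunction Θ) := by
  obtain ⟨T, D, hT, hD, hP, hQ, h₁, h₂, hrep⟩ := hΘ.exists_isPositiveRep
  have hdiff : ∀ z ∈ extDomain, DifferentiableAt ℂ (fun z => D + T (blaschke z)) z := fun z hz =>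
    let Tc : C(Set.Icc (-1 : ℝ) 1, ℂ) →L[ℂ] (N →L[ℂ] N) := ⟨T, hT.continuous⟩
    (Tc.differentiableAt.comp z (differentiableAt_blaschke hz)).const_add D
  have hcont : ∀ z ∈ extDomain, ContinuousAt (fun z => D + T (blaschke z)) z := fun z hz =>
    (hdiff z hz).continuousAt
  have hbv : ∀ z ∈ extDomain, IsBoundaryValue Θ z (D + T (blaschke z)) := fun z hz =>
    isBoundaryValue_of_continuousAt (hcont z hz) hrep
  have hschur : IsSchur Θ := by
    refine ⟨fun z hz => ?_, fun z hz => ?_⟩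
    · have hz' := mem_ball_zero_iff.1 hz
      exact ((hdiff z (mem_extDomain_of_norm_lt_one hz')).differentiableWithinAt).congr
        (fun w hw => hrep w (mem_ball_zero_iff.1 hw)) (hrep z hz')
    · have hz' := mem_ball_zero_iff.1 hz
      rw [hrep z hz']
      exact hT.norm_add_blaschke_le hD hz'
  have hconj : ∀ {ξ : ℂ}, ξ ≠ 1 → ξ ≠ -1 →
      (starRingEnd ℂ) ξ ≠ 1 ∧ (starRingEnd ℂ) ξ ≠ -1 := fun {ξ} h1 h2 =>
    ⟨fun h => h1 (by simpa using congrArg (starRingEnd ℂ) h),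
      fun h => h2 (by simpa using congrArg (starRingEnd ℂ) h)⟩
  have hG : (1 / 2 : ℂ) • ((D + T 1) - (D - T 1)) = T 1 := by
    rw [add_sub_sub_cancel, ← two_smul ℂ, smul_smul]; norm_num
  have hS : (D + T 1) + (D - T 1) = (2 : ℂ) • D := by
    rw [add_add_sub_cancel, two_smul]
  have hR : (4 : ℂ) • (1 : N →L[ℂ] N) - (2 : ℂ) • ((D + T 1) - (D - T 1)) =
      (4 : ℂ) • (1 - T 1) := by
    rw [add_sub_sub_cancel, ← two_smul ℂ, smul_smul, smul_sub]; norm_num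
  have hl : star ((2 : ℂ) • D) * ((2 : ℂ) • D) = (4 : ℂ) • (star D * D) := by
    rw [star_smul, smul_mul_smul_comm]; congr 1; norm_num
  have hr : ((2 : ℂ) • D) * star ((2 : ℂ) • D) = (4 : ℂ) • (D * star D) := by
    rw [star_smul, smul_mul_smul_comm]; congr 1; norm_num
  have h4 : (4 : ℂ) ≠ 0 := by norm_num
  have hstar := hT.star_map_one
  refine ⟨D + T 1, D - T 1, hP, hQ, ?_⟩
  rw [hG, hS, hR, hl, hr]
  refine ⟨fun hin => ?_, fun hco => ?_, fun hproj hDD => ?_, fun hproj hDD => ?_⟩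
  · obtain ⟨hp, hDD⟩ := hT.isometric_necessary hD h₁ h₂ fun ξ hξ h1 h2 =>
      forall_circle_of_ae hcont hrep (q := fun L => star L * L) (by fun_prop) hin.2 hξ
        (mem_extDomain_of_norm_eq_one hξ h1 h2)
    exact ⟨⟨hp, hstar⟩, by rw [hDD]⟩
  -- Co-isometry of D + T(b_{ξ̄}) is isometry of D* + T(b_ξ), so the inner case applies to D* with
  -- the same T.
  · obtain ⟨hp, hDD⟩ := hT.isometric_necessary hD.star h₁ h₂ fun ξ hξ h1 h2 => by
      have hd := mem_extDomain_of_norm_eq_one hξ h1 h2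
      have h := forall_circle_of_ae hcont hrep (q := fun L => L * star L) (by fun_prop) hco.2
        (ξ := (starRingEnd ℂ) ξ) (by simpa using hξ) (conj_mem_extDomain hd)
      simp only [hT.star_add_map_blaschke D (conj_mem_extDomain hd), Complex.conj_conj] at h
      rwa [hT.star_add_map_blaschke _ hd, star_star]
    rw [star_star] at hDD
    exact ⟨⟨hp, hstar⟩, by rw [hDD]⟩
  · rintro ⟨ξ, L, hξ, hξ1, hξ2, hL, hLL⟩
    rw [pow_two] at hproj
    have hξd := mem_extDomain_of_norm_eq_one hξ hξ1 hξ2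
    rw [hL.unique hξ (hbv ξ hξd)] at hLL
    refine ⟨hschur, ?_⟩
    filter_upwards [ae_exp_mul_I_ne] with t ht
    have hd := mem_extDomain_of_norm_eq_one (norm_exp_mul_I t) ht.1 ht.2
    exact ⟨_, hbv _ hd, hT.isometric_of_point hD hproj (smul_right_injective _ h4 hDD) hξ hξd
      (norm_exp_mul_I t) hd hLL⟩
  · rintro ⟨ξ, L, hξ, hξ1, hξ2, hL, hLL⟩
    rw [pow_two] at hproj
    have hξd := mem_extDomain_of_norm_eq_one hξ hξ1 hξ2
    rw [hL.unique hξ (hbv ξ hξd), hT.star_add_map_blaschke D hξd] at hLL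
    refine ⟨hschur, ?_⟩
    filter_upwards [ae_exp_mul_I_ne] with t ht
    have hd := mem_extDomain_of_norm_eq_one (norm_exp_mul_I t) ht.1 ht.2
    refine ⟨_, hbv _ hd, ?_⟩
    -- The inner case for D*, from the conjugate of the given point to the conjugate of e^{it}.
    have h := hT.isometric_of_point hD.star hproj
      (by rw [star_star]; exact smul_right_injective _ h4 hDD)
      (ξ := (starRingEnd ℂ) ξ) (η := (starRingEnd ℂ) (Complex.exp (t * I)))
      (by simpa using hξ) (conj_mem_extDomain hξd) (by simp)
      (conj_mem_extDomain hd)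
      (by rwa [hT.star_add_map_blaschke _ (conj_mem_extDomain hξd), star_star, Complex.conj_conj])
    rwa [hT.star_add_map_blaschke _ (conj_mem_extDomain hd), star_star, Complex.conj_conj,
      ← hT.star_add_map_blaschke D hd] at h
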